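/- Let $n\in\mathbb{Z}$ and let $T_{2n}$ be the twist knot with the diagram consisting of a clasp of two left-handed crossings and a twist region of $2n$ right-handed half twists ($2|n|$ left-handed ones if $n<0$); so $T_2$ is the figure-eight knot and $T_{-2}$ the right-handed trefoil. Let $\mu,\lambda$ be a meridian and its preferred longitude in the knot group $\pi_1(S^3\setminus T_{2n})$. The A-polynomial $A_{2n}(L,M)\in\mathbb{Z}[L,M]$ is the polynomial, determined up to sign, with coprime coefficients and no repeated factors, whose complex irreducible factors are the equations of the irreducible plane curves, other than the line $L=1$, contained in the Zariski closure in $\mathbb{C}^2$ of the set of pairs $(L,M)$ for which there is a representation $\rho$ of the knot group in $SL(2,\mathbb{C})$ with $$\rho(\lambda)=\begin{pmatrix}L&*\\0&L^{-1}\end{pmatrix},\qquad \rho(\mu)=\begin{pmatrix}M&*\\0&M^{-1}\end{pmatrix}.$$ Then, up to sign, $A_{2n}$ is given explicitly as follows. If $n\ge 0$, $$A_{2n}=-M^{2n}(1+LM^2)^{2n}\sum_{i=0}^{2n}\binom{n+\lfloor i/2\rfloor}{i}(1-M^2)^i(1+LM^2)^{-i}(L-1)^{\lfloor i/2\rfloor}\left(LM^2-M^{-2}\right)^{\lfloor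 (1+i)/2\rfloor},$$ and if $n<0$, $$A_{2n}=M^{-2n}(1+LM^2)^{-2n-1}\sum_{i=0}^{-2n-1}\binom{-n+\lfloor (i-1)/2\rfloor}{i}(M^2-1)^i(1+LM^2)^{-i}(L-1)^{\lfloor i/2\rfloor}\left(LM^2-M^{-2}\right)^{\lfloor (1+i)/2\rfloor}.$$ -/

import Mathlib

open MvPolynomial

/-! ### Oriented knot diagrams and the peripheral system of a knot -/

/-- An oriented knot diagram, recorded by its signed Gauss code.  Travelling once along the knot one
passes the crossings at `N` positions (so there are `N / 2` crossings, each passed twice).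
`partner k` is the other position at which the crossing met at position `k` is passed,
`isOver k` tells whether the passage at position `k` is the upper one, and
`sign k` is the sign (`1` for a positive, i.e. right-handed, crossing, `-1` for a negative one)
of the crossing met at position `k`. -/
structure SignedGaussCode (N : ℕ) where
  partner : Fin N → Fin N
  isOver : Fin N → Bool
  sign : Fin N → ℤˣ
  partner_partner : ∀ k, partner (partner k) = k
  isOver_partner : ∀ k, isOver (partner k) = !(isOver k)
  sign_partner : ∀ k, sign (partner k) = sign k

namespace SignedGaussCode

variable {N : ℕ}

/-- The Wirtinger relators.  There is one generator for each edge of the diagram; the edge `k` ends,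
and the edge `k + 1` (cyclically) starts, at position `k`.  Along an overpass the generator does not
change; when the strand passes, at a crossing of sign `ε`, under the strand with generator `c`, the
generator `a` becomes `c ^ (-ε) * a * c ^ ε`. -/
def wirtingerRelator (D : SignedGaussCode N) (k : Fin N) : FreeGroup (Fin N) :=
  (FreeGroup.of (finRotate N k))⁻¹ *
    (if D.isOver k then FreeGroup.of k
     else FreeGroup.of (D.partner k) ^ (-(D.sign k : ℤ)) * FreeGroup.of k *
      FreeGroup.of (D.partner k) ^ (D.sign k : ℤ))

/-- The knot group, by its Wirtinger presentation. -/
abbrev KnotGroup (D : SignedGaussCode N) : Type :=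
  PresentedGroup (Set.range D.wirtingerRelator)

/-- The Wirtinger generator of an edge (a meridian of the knot). -/
def gen (D : SignedGaussCode N) (k : Fin N) : D.KnotGroup :=
  PresentedGroup.of k

/-- The writhe: the sum of the signs of all crossings (each has exactly one underpass). -/
def writhe (D : SignedGaussCode N) : ℤ :=
  ∑ k : Fin N, if D.isOver k then 0 else (D.sign k : ℤ)

/-- The meridian at the base edge. -/
def meridian [NeZero N] (D : SignedGaussCode N) : D.KnotGroup := D.gen 0

/-- The preferred longitude based at the base edge: the product, in the order in which the knot is
travelled, of the overcrossing generators with the signs of the crossings, over all underpasses,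
corrected by a power of the meridian so that it is null-homologous in the exterior of the knot. -/
def longitude [NeZero N] (D : SignedGaussCode N) : D.KnotGroup :=
  ((List.finRange N).map fun k =>
    if D.isOver k then 1 else D.gen (D.partner k) ^ (D.sign k : ℤ)).prod *
      D.meridian ^ (-D.writhe)

end SignedGaussCode

/-! ### The twist knots -/

/-- The position is one of the passages through the horizontal twist region of the diagram of
`T_{2n}`, where `p = |n|`. -/
def IsTwistPosition (p k : ℕ) : Prop := k < 2 * p ∨ (2 * p + 2 ≤ k ∧ k ≤ 4 * p + 1)

instance (p k : ℕ) : Decidable (IsTwistPosition p k) := by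
  unfold IsTwistPosition; infer_instance

/-- The standard diagram of the twist knot `T_{2n}`: a clasp of two left-handed crossings and a
horizontal twist region of `2n` right-handed crossings (that is, `2|n|` left-handed ones if `n < 0`).
With `p = |n|`, the knot runs through the twist crossings `1, …, 2p` (positions `0, …, 2p - 1`), then
through the clasp crossings `a`, `b`, then back through the twist crossings `2p, …, 1`, and finally
through the clasp crossings `b`, `a`.  The two strands are antiparallel both in the clasp and in the
twist region, hence left-handed twisting gives positive crossings and right-handed twisting gives
negative ones.  For `n ≥ 0` the diagram is alternating; for `n < 0` all the twist crossings are
switched. -/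
def twistKnot (n : ℤ) : SignedGaussCode (4 * n.natAbs + 4) where
  partner k :=
    if h : IsTwistPosition n.natAbs k then ⟨4 * n.natAbs + 1 - k, by omega⟩
    else ⟨6 * n.natAbs + 3 - k, by unfold IsTwistPosition at h; omega⟩
  isOver k :=
    if IsTwistPosition n.natAbs k then xor (decide (Even (k : ℕ))) (decide (n < 0))
    else decide (Even (k : ℕ))
  sign k := if IsTwistPosition n.natAbs k then (if n < 0 then 1 else -1) else 1
  partner_partner k := by
    have hk := k.isLt
    by_cases h : IsTwistPosition n.natAbs k
    · have h' : IsTwistPosition n.natAbs (4 * n.natAbs + 1 - k) := by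
        unfold IsTwistPosition at *; omega
      ext
      simp only [h, h', dite_true]
      unfold IsTwistPosition at h; omega
    · have h' : ¬ IsTwistPosition n.natAbs (6 * n.natAbs + 3 - k) := by
        unfold IsTwistPosition at *; omega
      ext
      simp only [h, h', dite_false]
      unfold IsTwistPosition at h; omega
  isOver_partner k := by
    have hk := k.isLt
    by_cases h : IsTwistPosition n.natAbs k
    · have h' : IsTwistPosition n.natAbs (4 * n.natAbs + 1 - k) := by
        unfold IsTwistPosition at *; omega
      have e : Even (4 * n.natAbs + 1 - (k : ℕ)) ↔ ¬ Even (k : ℕ) := by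
        unfold IsTwistPosition at h; grind
      simp only [h, h', e, dite_true, if_true, decide_not, Bool.not_xor]
    · have h' : ¬ IsTwistPosition n.natAbs (6 * n.natAbs + 3 - k) := by
        unfold IsTwistPosition at *; omega
      have e : Even (6 * n.natAbs + 3 - (k : ℕ)) ↔ ¬ Even (k : ℕ) := by
        unfold IsTwistPosition at h; grind
      simp only [h, h', e, dite_false, if_false, decide_not]
  sign_partner k := by
    have hk := k.isLt
    by_cases h : IsTwistPosition n.natAbs k
    · have h' : IsTwistPosition n.natAbs (4 * n.natAbs + 1 - k) := by
        unfold IsTwistPosition at *; omega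
      simp [h, h']
    · have h' : ¬ IsTwistPosition n.natAbs (6 * n.natAbs + 3 - k) := by
        unfold IsTwistPosition at *; omega
      simp [h, h']

/-! ### The A-polynomial -/

section APolynomial

/-- The set of the pairs `(L, M)` (stored as `![L, M]`) for which some representation
`ρ : G → SL(2, ℂ)` sends `μ` and `l` to upper triangular matrices with upper left entries `M` and
`L` (so `L` and `M` are eigenvalues with a common eigenvector). -/
def eigenvalueSet {G : Type*} [Group G] (μ l : G) : Set (Fin 2 → ℂ) :=
  {v | ∃ ρ : G →* Matrix.SpecialLinearGroup (Fin 2) ℂ,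
    (ρ l) 1 0 = 0 ∧ (ρ μ) 1 0 = 0 ∧ (ρ l) 0 0 = v 0 ∧ (ρ μ) 0 0 = v 1}

/-- The eigenvalue variety: the Zariski closure in `ℂ²` of the set of eigenvalue pairs. -/
def eigenvalueVariety {G : Type*} [Group G] (μ l : G) : Set (Fin 2 → ℂ) :=
  zeroLocus ℂ (vanishingIdeal ℂ (eigenvalueSet μ l))

/-- `A(L, M)` (with `X 0 = L` and `X 1 = M`) is the A-polynomial of the group `G` with meridian `μ`
and longitude `l`: it is an integer polynomial whose coefficients have no common factor, it has no
repeated factors, and its complex irreducible factors are the equations of the plane curves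
contained in the eigenvalue variety, other than the line `L = 1` which comes from the abelian
representations.  These conditions determine `A` up to sign. -/
structure IsAPolynomial {G : Type*} [Group G] (μ l : G) (A : MvPolynomial (Fin 2) ℤ) : Prop where
  primitive : ∀ d : ℤ, C d ∣ A → IsUnit d
  squarefree : Squarefree (map (Int.castRingHom ℂ) A)
  irreducible_dvd_iff : ∀ p : MvPolynomial (Fin 2) ℂ, Irreducible p →
    (p ∣ map (Int.castRingHom ℂ) A ↔
      zeroLocus ℂ (Ideal.span {p}) ⊆ eigenvalueVariety μ l ∧ ¬ Associated p (X 0 - 1))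

/-- The A-polynomial of a knot given by a diagram. -/
def SignedGaussCode.IsAPolynomial {N : ℕ} [NeZero N] (D : SignedGaussCode N)
    (A : MvPolynomial (Fin 2) ℤ) : Prop :=
  _root_.IsAPolynomial D.meridian D.longitude A

end APolynomial

/-- The explicit expression, in a field `K` with elements `L` and `M`. -/
noncomputable def explicitA {K : Type*} [Field K] (n : ℤ) (L M : K) : K :=
  if 0 ≤ n then
    -M ^ (2 * n) * (1 + L * M ^ 2) ^ (2 * n) *
      ∑ i ∈ Finset.range ((2 * n).toNat + 1),
        ((n + (i : ℤ) / 2).toNat.choose i : K) * (1 - M ^ 2) ^ i *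
          (1 + L * M ^ 2) ^ (-(i : ℤ)) *
          (L - 1) ^ (i / 2) * (L * M ^ 2 - M ^ (-2 : ℤ)) ^ ((1 + i) / 2)
  else
    M ^ (-2 * n) * (1 + L * M ^ 2) ^ (-2 * n - 1) *
      ∑ i ∈ Finset.range ((-2 * n - 1).toNat + 1),
        ((-n + ((i : ℤ) - 1) / 2).toNat.choose i : K) * (M ^ 2 - 1) ^ i *
          (1 + L * M ^ 2) ^ (-(i : ℤ)) *
          (L - 1) ^ (i / 2) * (L * M ^ 2 - M ^ (-2 : ℤ)) ^ ((1 + i) / 2)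

/-! The knot group is generated by two meridians `A` and `C`, the colours of the base edge and of
the edge entering the clasp. Put `v = A⁻¹ * (C * A * C⁻¹)` and `w = v ^ n`. All Wirtinger relations
reduce to `C * w = w * A`, and the longitude becomes `w⁻¹ * A * w * A⁻¹ * C * A⁻¹`, which commutes
with `A` (`TwistKnot.exists_generator`, `TwistKnot.exists_hom`).

For `M ^ 2 ≠ 1` one may take `A` to be diag(M, M⁻¹). Let p, s be the diagonal entries of `C`. The
longitude is then diagonal, and its entry L satisfies p = L M² s; with p + s = M + M⁻¹ this gives p
and s whenever 1 + L M² ≠ 0. With x = tr v - 2, Cayley–Hamilton gives v^n = f + g (v - (1 + x)),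
where f, g are polynomials in x, and the relation reduces to a Riley equation linear in f and g.
Substituting x as a rational function of L, M and clearing denominators gives `apoly`. Conversely a
zero of `apoly` outside M = 0, M⁴ = 1, 1 + L M² = 0 yields a representation
(`TwistKnot.mem_eigenvalueSet_of_apoly`). By the Nullstellensatz these exceptional curves and the
finitely many points with L² = M² = 1 do not affect the curves in the closure.

There are no repeated factors because, for generic M, `apoly` has as many distinct roots L as its
degree allows. Eliminating L gives (κ - e) f(e) g(e) = 1 for e = x and κ = (M - M⁻¹)², a polynomial
in e of that same degree; it has simple roots for all but finitely many κ, and distinct e come from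
distinct L (`Polynomial.not_sq_dvd_apoly`).

The explicit sum is `apoly` with f and g expanded in binomial coefficients: even indices give f, odd
indices give g (`TwistKnot.explicitA_eq_apoly`). -/

namespace SignedGaussCode

/-! ### Representations of a Wirtinger presentation as colourings -/

variable {N : ℕ} {H : Type*} [Group H]

/-- A colouring of the edges of a diagram by group elements that satisfies the Wirtinger relations. -/
def IsColoring (D : SignedGaussCode N) (x : Fin N → H) : Prop :=
  ∀ k, x (finRotate N k) = if D.isOver k then x k else
    x (D.partner k) ^ (-(D.sign k : ℤ)) * x k * x (D.partner k) ^ (D.sign k : ℤ)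

theorem lift_wirtingerRelator (D : SignedGaussCode N) (x : Fin N → H) (k : Fin N) :
    FreeGroup.lift x (D.wirtingerRelator k) = 1 ↔
      x (finRotate N k) = if D.isOver k then x k else
        x (D.partner k) ^ (-(D.sign k : ℤ)) * x k * x (D.partner k) ^ (D.sign k : ℤ) := by
  rw [wirtingerRelator, map_mul, map_inv, inv_mul_eq_one, FreeGroup.lift_apply_of]
  split_ifs <;> simp only [map_mul, map_zpow, FreeGroup.lift_apply_of]

theorem isColoring_map_gen (D : SignedGaussCode N) (ρ : D.KnotGroup →* H) :
    D.IsColoring fun k => ρ (D.gen k) := by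
  intro k
  have h : FreeGroup.lift (fun k => ρ (D.gen k)) =
      ρ.comp (PresentedGroup.mk (Set.range D.wirtingerRelator)) := by
    ext i
    simp [gen, PresentedGroup.of]
  apply (lift_wirtingerRelator D (fun k => ρ (D.gen k)) k).1
  rw [h, MonoidHom.comp_apply,
    PresentedGroup.one_of_mem (Set.mem_range_self k), map_one]

/-- The representation of the knot group determined by a colouring. -/
def IsColoring.toHom {D : SignedGaussCode N} {x : Fin N → H} (hx : D.IsColoring x) :
    D.KnotGroup →* H :=
  PresentedGroup.toGroup (f := x) (by
    rintro _ ⟨k, rfl⟩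
    exact (lift_wirtingerRelator D x k).2 (hx k))

theorem IsColoring.toHom_gen {D : SignedGaussCode N} {x : Fin N → H} (hx : D.IsColoring x)
    (k : Fin N) : hx.toHom (D.gen k) = x k :=
  PresentedGroup.toGroup.of _

end SignedGaussCode

/-! ### Wirtinger relations and longitude of the twist knot, indexed by natural numbers -/

namespace TwistKnot

variable {H : Type*} [Group H]

/-- The other position of the crossing met at position `k` of the diagram of `twistKnot n`. -/
def partner (n : ℤ) (k : ℕ) : ℕ :=
  if IsTwistPosition n.natAbs k then 4 * n.natAbs + 1 - k else 6 * n.natAbs + 3 - k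

/-- Whether position `k` of the diagram of `twistKnot n` is an overpass. -/
def isOver (n : ℤ) (k : ℕ) : Bool :=
  if IsTwistPosition n.natAbs k then xor (decide (Even k)) (decide (n < 0)) else decide (Even k)

/-- The sign of the crossing met at position `k` of the diagram of `twistKnot n`. -/
def sign (n : ℤ) (k : ℕ) : ℤ :=
  if IsTwistPosition n.natAbs k then (if n < 0 then 1 else -1) else 1

/-- The Wirtinger relations of `twistKnot n` for edges labelled by natural numbers. -/
def Rel (n : ℤ) (X : ℕ → H) : Prop :=
  X (4 * n.natAbs + 4) = X 0 ∧ ∀ k < 4 * n.natAbs + 4, X (k + 1) = if isOver n k then X k else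
    X (partner n k) ^ (-(sign n k)) * X k * X (partner n k) ^ (sign n k)

/-- The contribution of position `k` to the longitude. -/
def longitudeTerm (n : ℤ) (X : ℕ → H) (k : ℕ) : H :=
  if isOver n k then 1 else X (partner n k) ^ sign n k

theorem val_partner (n : ℤ) (k : Fin (4 * n.natAbs + 4)) :
    ((twistKnot n).partner k : ℕ) = partner n k := by
  simp only [twistKnot, partner]; split_ifs <;> rfl

theorem coe_sign (n : ℤ) (k : Fin (4 * n.natAbs + 4)) :
    ((twistKnot n).sign k : ℤ) = sign n k := by
  simp only [twistKnot, sign]; split_ifs <;> rfl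

/-- Edge labels indexed cyclically by natural numbers. -/
def cyc {H : Type*} {N : ℕ} [NeZero N] (x : Fin N → H) (k : ℕ) : H := x (Fin.ofNat N k)

theorem cyc_val {H : Type*} {N : ℕ} [NeZero N] (x : Fin N → H) (k : Fin N) : cyc x k = x k := by
  simp [cyc]

theorem isColoring_iff_rel (n : ℤ) (x : Fin (4 * n.natAbs + 4) → H) :
    (twistKnot n).IsColoring x ↔ Rel n (cyc x) := by
  have key : ∀ k : Fin (4 * n.natAbs + 4),
      (x (finRotate _ k) = if (twistKnot n).isOver k then x k else
        x ((twistKnot n).partner k) ^ (-((twistKnot n).sign k : ℤ)) * x k *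
          x ((twistKnot n).partner k) ^ ((twistKnot n).sign k : ℤ)) ↔
      (cyc x (k + 1) = if isOver n k then cyc x k else
        cyc x (partner n k) ^ (-(sign n k)) * cyc x k * cyc x (partner n k) ^ (sign n k)) := by
    intro k
    have h1 : cyc x (k + 1) = x (finRotate _ k) := by
      rw [cyc, finRotate_apply]; congr 1
    rw [h1, ← val_partner, cyc_val, cyc_val, coe_sign]
    rfl
  constructor
  · intro h
    exact ⟨by simp [cyc], fun k hk => (key ⟨k, hk⟩).1 (h ⟨k, hk⟩)⟩
  · intro h k
    exact (key k).2 (h.2 k k.isLt)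

theorem map_longitude (n : ℤ) (ρ : (twistKnot n).KnotGroup →* H) :
    ρ (twistKnot n).longitude =
      ((List.range (4 * n.natAbs + 4)).map
        (longitudeTerm n (cyc fun k => ρ ((twistKnot n).gen k)))).prod *
      cyc (fun k => ρ ((twistKnot n).gen k)) 0 ^ (-(twistKnot n).writhe) := by
  rw [SignedGaussCode.longitude, map_mul, map_zpow, map_list_prod, ← List.map_coe_finRange_eq_range,
    List.map_map, List.map_map]
  congr 1
  congr 1
  apply List.map_congr_left
  intro k _
  simp only [Function.comp, longitudeTerm, ← val_partner, cyc_val, ← coe_sign]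
  change ρ (if isOver n k then _ else _) = _
  split_ifs <;> simp

/-- Colouring every edge by the generator of ℤ turns the uncorrected longitude product into the
writhe, so the later evaluation of that product also computes the writhe. -/
theorem ofAdd_writhe (n : ℤ) : Multiplicative.ofAdd (twistKnot n).writhe =
    ((List.range (4 * n.natAbs + 4)).map
      (longitudeTerm n fun _ => Multiplicative.ofAdd (1 : ℤ))).prod := by
  rw [SignedGaussCode.writhe, ofAdd_sum, ← List.prod_ofFn, List.ofFn_eq_map,
    ← List.map_coe_finRange_eq_range, List.map_map]
  congr 1
  apply List.map_congr_left
  intro k _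
  simp only [Function.comp, longitudeTerm, ← coe_sign]
  change Multiplicative.ofAdd (if isOver n k then _ else _) = _
  split_ifs
  · rfl
  · rw [← ofAdd_zsmul]; simp

end TwistKnot

/-! ### The relations sorted by crossing -/

namespace TwistKnot

variable {H : Type*} [Group H]

/-- The positions of the diagram of a twist knot, sorted by the crossings. -/
theorem forall_position_iff (p : ℕ) (P : ℕ → Prop) : (∀ k < 4 * p + 4, P k) ↔
    (∀ j < p, P (2 * j) ∧ P (2 * j + 1) ∧ P (4 * p - 2 * j) ∧ P (4 * p - 2 * j + 1)) ∧
    P (2 * p) ∧ P (2 * p + 1) ∧ P (4 * p + 2) ∧ P (4 * p + 3) := by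
  constructor
  · intro h
    exact ⟨fun j hj => ⟨h _ (by omega), h _ (by omega), h _ (by omega), h _ (by omega)⟩,
      h _ (by omega), h _ (by omega), h _ (by omega), h _ (by omega)⟩
  · rintro ⟨h, h1, h2, h3, h4⟩ k hk
    rcases Nat.even_or_odd' k with ⟨c, rfl | rfl⟩
    · rcases lt_trichotomy c p with a | rfl | a
      · exact (h c a).1
      · exact h1
      · by_cases d : c = 2 * p + 1
        · rwa [show 2 * c = 4 * p + 2 by omega]
        have := (h (2 * p - c) (by omega)).2.2.1
        rwa [show 4 * p - 2 * (2 * p - c) = 2 * c by omega] at this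
    · rcases lt_trichotomy c p with a | rfl | a
      · exact (h c a).2.1
      · exact h2
      · by_cases d : c = 2 * p + 1
        · rwa [show 2 * c + 1 = 4 * p + 3 by omega]
        have := (h (2 * p - c) (by omega)).2.2.2
        rwa [show 4 * p - 2 * (2 * p - c) + 1 = 2 * c + 1 by omega] at this

theorem partner_sign_of_twist {n : ℤ} {p : ℕ} (hp : n.natAbs = p) {k l : ℕ}
    (h : k + l = 4 * p + 1) (h' : k < 2 * p ∨ l < 2 * p) :
    partner n k = l ∧ sign n k = (if n < 0 then 1 else -1) ∧
      isOver n k = xor (decide (Even k)) (decide (n < 0)) := by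
  have hk : IsTwistPosition n.natAbs k := by rw [hp]; unfold IsTwistPosition; omega
  exact ⟨by rw [partner, if_pos hk, hp]; omega, by rw [sign, if_pos hk], by rw [isOver, if_pos hk]⟩

theorem partner_sign_of_clasp {n : ℤ} {p : ℕ} (hp : n.natAbs = p) {k l : ℕ}
    (h : k + l = 6 * p + 3) (h' : k = 2 * p ∨ k = 2 * p + 1 ∨ l = 2 * p ∨ l = 2 * p + 1) :
    partner n k = l ∧ sign n k = 1 ∧ isOver n k = decide (Even k) := by
  have hk : ¬ IsTwistPosition n.natAbs k := by rw [hp]; unfold IsTwistPosition; omega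
  exact ⟨by rw [partner, if_neg hk, hp]; omega, by rw [sign, if_neg hk], by rw [isOver, if_neg hk]⟩

theorem odd_decide_even {k j : ℕ} (h : k = 2 * j + 1) : decide (Even k) = false := by
  subst h; simp

theorem even_decide_even {k j : ℕ} (h : k = 2 * j) : decide (Even k) = true := by
  subst h; simp

theorem rel_ofNat_iff (p : ℕ) (X : ℕ → H) : Rel (p : ℤ) X ↔ X (4 * p + 4) = X 0 ∧
    (∀ j < p, X (2 * j + 1) = X (2 * j) ∧
      X (2 * j + 2) = X (4 * p - 2 * j) * X (2 * j + 1) * (X (4 * p - 2 * j))⁻¹ ∧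
      X (4 * p - 2 * j + 1) = X (4 * p - 2 * j) ∧
      X (4 * p - 2 * j + 2) = X (2 * j) * X (4 * p - 2 * j + 1) * (X (2 * j))⁻¹) ∧
    X (2 * p + 1) = X (2 * p) ∧
    X (2 * p + 2) = (X (4 * p + 2))⁻¹ * X (2 * p + 1) * X (4 * p + 2) ∧
    X (4 * p + 3) = X (4 * p + 2) ∧
    X (4 * p + 4) = (X (2 * p))⁻¹ * X (4 * p + 3) * X (2 * p) := by
  have hp : (p : ℤ).natAbs = p := Int.natAbs_natCast p
  have h0 : ¬ (p : ℤ) < 0 := by omega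
  unfold Rel
  rw [hp, forall_position_iff]
  refine and_congr_right' (and_congr (forall₂_congr fun j hj => ?_) ?_)
  · obtain ⟨a1, a2, a3⟩ := partner_sign_of_twist hp (k := 2 * j) (l := 4 * p - 2 * j + 1)
      (by omega) (by omega)
    obtain ⟨b1, b2, b3⟩ := partner_sign_of_twist hp (k := 2 * j + 1) (l := 4 * p - 2 * j)
      (by omega) (by omega)
    obtain ⟨c1, c2, c3⟩ := partner_sign_of_twist hp (l := 2 * j + 1) (k := 4 * p - 2 * j)
      (by omega) (by omega)
    obtain ⟨d1, d2, d3⟩ := partner_sign_of_twist hp (l := 2 * j) (k := 4 * p - 2 * j + 1)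
      (by omega) (by omega)
    rw [even_decide_even (j := j) rfl] at a3
    rw [odd_decide_even (j := j) rfl] at b3
    rw [even_decide_even (j := 2 * p - j) (by omega)] at c3
    rw [odd_decide_even (j := 2 * p - j) (by omega)] at d3
    simp [*]
  · obtain ⟨a1, a2, a3⟩ := partner_sign_of_clasp hp (k := 2 * p) (l := 4 * p + 3)
      (by omega) (by omega)
    obtain ⟨b1, b2, b3⟩ := partner_sign_of_clasp hp (k := 2 * p + 1) (l := 4 * p + 2)
      (by omega) (by omega)
    obtain ⟨c1, c2, c3⟩ := partner_sign_of_clasp hp (l := 2 * p + 1) (k := 4 * p + 2)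
      (by omega) (by omega)
    obtain ⟨d1, d2, d3⟩ := partner_sign_of_clasp hp (l := 2 * p) (k := 4 * p + 3)
      (by omega) (by omega)
    rw [even_decide_even (j := p) rfl] at a3
    rw [odd_decide_even (j := p) rfl] at b3
    rw [even_decide_even (j := 2 * p + 1) (by omega)] at c3
    rw [odd_decide_even (j := 2 * p + 1) (by omega)] at d3
    simp [*]

theorem rel_neg_iff (n : ℤ) (hn : n < 0) (p : ℕ) (hp : n.natAbs = p) (X : ℕ → H) : Rel n X ↔
    X (4 * p + 4) = X 0 ∧
    (∀ j < p,
      X (2 * j + 1) = (X (4 * p - 2 * j + 1))⁻¹ * X (2 * j) * X (4 * p - 2 * j + 1) ∧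
      X (2 * j + 2) = X (2 * j + 1) ∧
      X (4 * p - 2 * j + 1) = (X (2 * j + 1))⁻¹ * X (4 * p - 2 * j) * X (2 * j + 1) ∧
      X (4 * p - 2 * j + 2) = X (4 * p - 2 * j + 1)) ∧
    X (2 * p + 1) = X (2 * p) ∧
    X (2 * p + 2) = (X (4 * p + 2))⁻¹ * X (2 * p + 1) * X (4 * p + 2) ∧
    X (4 * p + 3) = X (4 * p + 2) ∧
    X (4 * p + 4) = (X (2 * p))⁻¹ * X (4 * p + 3) * X (2 * p) := by
  unfold Rel
  rw [hp, forall_position_iff]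
  refine and_congr_right' (and_congr (forall₂_congr fun j hj => ?_) ?_)
  · obtain ⟨a1, a2, a3⟩ := partner_sign_of_twist hp (k := 2 * j) (l := 4 * p - 2 * j + 1)
      (by omega) (by omega)
    obtain ⟨b1, b2, b3⟩ := partner_sign_of_twist hp (k := 2 * j + 1) (l := 4 * p - 2 * j)
      (by omega) (by omega)
    obtain ⟨c1, c2, c3⟩ := partner_sign_of_twist hp (l := 2 * j + 1) (k := 4 * p - 2 * j)
      (by omega) (by omega)
    obtain ⟨d1, d2, d3⟩ := partner_sign_of_twist hp (l := 2 * j) (k := 4 * p - 2 * j + 1)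
      (by omega) (by omega)
    rw [even_decide_even (j := j) rfl] at a3
    rw [odd_decide_even (j := j) rfl] at b3
    rw [even_decide_even (j := 2 * p - j) (by omega)] at c3
    rw [odd_decide_even (j := 2 * p - j) (by omega)] at d3
    simp [*]
  · obtain ⟨a1, a2, a3⟩ := partner_sign_of_clasp hp (k := 2 * p) (l := 4 * p + 3)
      (by omega) (by omega)
    obtain ⟨b1, b2, b3⟩ := partner_sign_of_clasp hp (k := 2 * p + 1) (l := 4 * p + 2)
      (by omega) (by omega)
    obtain ⟨c1, c2, c3⟩ := partner_sign_of_clasp hp (l := 2 * p + 1) (k := 4 * p + 2)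
      (by omega) (by omega)
    obtain ⟨d1, d2, d3⟩ := partner_sign_of_clasp hp (l := 2 * p) (k := 4 * p + 3)
      (by omega) (by omega)
    rw [even_decide_even (j := p) rfl] at a3
    rw [odd_decide_even (j := p) rfl] at b3
    rw [even_decide_even (j := 2 * p + 1) (by omega)] at c3
    rw [odd_decide_even (j := 2 * p + 1) (by omega)] at d3
    simp [*]
end TwistKnot

/-! ### Reduction to two generators and one relation -/

namespace TwistKnot

/-- Extends sequences of labels of the two strands of the twist region to all edges. -/
def strandColor {H : Type*} (p : ℕ) (a b : ℕ → H) (k : Fin (4 * p + 4)) : H :=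
  if (k : ℕ) ≤ 2 * p then a k else if (k : ℕ) = 2 * p + 1 then a (2 * p) else b (4 * p + 2 - k)

theorem cyc_strandColor {H : Type*} (p : ℕ) (a b : ℕ → H) :
    (∀ k ≤ 2 * p, cyc (strandColor p a b) k = a k) ∧
    (∀ k l, k + l = 4 * p + 2 → l ≤ 2 * p → cyc (strandColor p a b) k = b l) ∧
    cyc (strandColor p a b) (2 * p + 1) = a (2 * p) ∧
    cyc (strandColor p a b) (4 * p + 3) = b 0 ∧
    cyc (strandColor p a b) (4 * p + 4) = a 0 := by
  refine ⟨fun k hk => ?_, fun k l h hl => ?_, ?_, ?_, ?_⟩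
  · simp [cyc, strandColor, Nat.mod_eq_of_lt (show k < 4 * p + 4 by omega), hk]
  · have e : 4 * p + 2 - k = l := by omega
    simp [cyc, strandColor, Nat.mod_eq_of_lt (show k < 4 * p + 4 by omega), e,
      show ¬ k ≤ 2 * p by omega, show k ≠ 2 * p + 1 by omega]
  · simp [cyc, strandColor, Nat.mod_eq_of_lt (show 2 * p + 1 < 4 * p + 4 by omega)]
  · simp [cyc, strandColor,
      show ¬ 4 * p + 3 ≤ 2 * p by omega, show 4 * p + 3 ≠ 2 * p + 1 by omega]
  · simp [cyc, strandColor]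

variable {H : Type*} [Group H]

/-- This is the redundant Wirtinger relation, at the other clasp crossing. With B = C A C⁻¹ = A v,
both sides equal C v. -/
theorem clasp_relation {A C v : H} {n : ℤ} (hv : v = A⁻¹ * (C * A * C⁻¹))
    (hC : C = v ^ n * A * (v ^ n)⁻¹) :
    v ^ n * (C * A * C⁻¹) * (v ^ n)⁻¹ = (C * A * C⁻¹)⁻¹ * C * (C * A * C⁻¹) := by
  have e : C * A * C⁻¹ = A * v := by rw [hv]; group
  calc v ^ n * (C * A * C⁻¹) * (v ^ n)⁻¹ = (v ^ n * A * (v ^ n)⁻¹) * v := by rw [e]; group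
    _ = C * v := by rw [← hC]
    _ = _ := by rw [hv]; group

theorem exists_rel_ofNat (p : ℕ) (A C v : H) (hv : v = A⁻¹ * (C * A * C⁻¹))
    (hC : C = v ^ (p : ℤ) * A * (v ^ (p : ℤ))⁻¹) :
    ∃ x : Fin (4 * p + 4) → H, Rel (p : ℤ) (cyc x) ∧ cyc x 0 = A ∧ cyc x (2 * p) = C := by
  set B := C * A * C⁻¹ with hB
  -- Each full twist conjugates both strands by `v`. The outgoing strand is over at even positions,
  -- so its colour changes only after odd ones: hence the floor of k / 2. For negative n the
  -- crossings are switched and the rounding is exchanged between the two strands.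
  set a : ℕ → H := fun k => v ^ (k / 2) * A * (v ^ (k / 2))⁻¹ with ha
  set b : ℕ → H := fun k => v ^ ((k + 1) / 2) * B * (v ^ ((k + 1) / 2))⁻¹ with hb
  obtain ⟨h1, h2, h3, h4, h5⟩ := cyc_strandColor p a b
  have eB : B = A * v := by rw [hv]; group
  have hC' : a (2 * p) = C := by simp [ha, hC]
  have key := clasp_relation hv hC
  rw [← hB] at key
  refine ⟨strandColor p a b, ?_, by rw [h1 0 (by omega)]; simp [ha], by rw [h1 _ le_rfl, hC']⟩
  rw [rel_ofNat_iff, h5, h1 0 (by omega)]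
  refine ⟨rfl, fun j hj => ?_, ?_, ?_, ?_, ?_⟩
  · rw [h1 (2 * j) (by omega), h1 (2 * j + 1) (by omega), h1 (2 * j + 2) (by omega),
      h2 (4 * p - 2 * j) (2 * j + 2) (by omega) (by omega),
      h2 (4 * p - 2 * j + 1) (2 * j + 1) (by omega) (by omega),
      h2 (4 * p - 2 * j + 2) (2 * j) (by omega) (by omega)]
    simp only [ha, hb, show (2 * j) / 2 = j by omega, show (2 * j + 1) / 2 = j by omega,
      show (2 * j + 2) / 2 = j + 1 by omega,
      show (2 * j + 2 + 1) / 2 = j + 1 by omega, eB]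
    refine ⟨trivial, ?_, trivial, ?_⟩ <;> group
  · rw [h3, h1 _ le_rfl]
  · rw [h3, hC', h2 (2 * p + 2) (2 * p) (by omega) (by omega), h2 (4 * p + 2) 0 (by omega) (by omega)]
    have e0 : b 0 = B := by simp [hb]
    have e1 : b (2 * p) = v ^ (p : ℤ) * B * (v ^ (p : ℤ))⁻¹ := by
      simp [hb, show (2 * p + 1) / 2 = p by omega]
    rw [e0, e1, key]
  · rw [h4, h2 (4 * p + 2) 0 (by omega) (by omega)]
  · rw [h4, h1 _ le_rfl, hC']
    simp [ha, hb, hB, mul_assoc]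

theorem exists_rel_neg (n : ℤ) (hn : n < 0) (p : ℕ) (hp : n.natAbs = p) (A C v : H)
    (hv : v = A⁻¹ * (C * A * C⁻¹)) (hC : C = v ^ n * A * (v ^ n)⁻¹) :
    ∃ x : Fin (4 * p + 4) → H, Rel n (cyc x) ∧ cyc x 0 = A ∧ cyc x (2 * p) = C := by
  have hnp : n = -(p : ℤ) := by omega
  set B := C * A * C⁻¹ with hB
  set a : ℕ → H := fun k => (v ^ ((k + 1) / 2))⁻¹ * A * v ^ ((k + 1) / 2) with ha
  set b : ℕ → H := fun k => (v ^ (k / 2))⁻¹ * B * v ^ (k / 2) with hb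
  obtain ⟨h1, h2, h3, h4, h5⟩ := cyc_strandColor p a b
  have eB : B = A * v := by rw [hv]; group
  have hC' : a (2 * p) = C := by simp [ha, hC, hnp, show (2 * p + 1) / 2 = p by omega]
  have key := clasp_relation hv hC
  rw [← hB] at key
  refine ⟨strandColor p a b, ?_, by rw [h1 0 (by omega)]; simp [ha], by rw [h1 _ le_rfl, hC']⟩
  rw [rel_neg_iff n hn p hp, h5, h1 0 (by omega)]
  refine ⟨rfl, fun j hj => ?_, ?_, ?_, ?_, ?_⟩
  · rw [h1 (2 * j) (by omega), h1 (2 * j + 1) (by omega), h1 (2 * j + 2) (by omega),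
      h2 (4 * p - 2 * j) (2 * j + 2) (by omega) (by omega),
      h2 (4 * p - 2 * j + 1) (2 * j + 1) (by omega) (by omega),
      h2 (4 * p - 2 * j + 2) (2 * j) (by omega) (by omega)]
    simp only [ha, hb, show (2 * j) / 2 = j by omega, show (2 * j + 1) / 2 = j by omega,
      show (2 * j + 2) / 2 = j + 1 by omega,
      show (2 * j + 2 + 1) / 2 = j + 1 by omega, eB]
    refine ⟨?_, trivial, ?_, trivial⟩ <;> group
  · rw [h3, h1 _ le_rfl]
  · rw [h3, hC', h2 (2 * p + 2) (2 * p) (by omega) (by omega), h2 (4 * p + 2) 0 (by omega) (by omega)]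
    have e0 : b 0 = B := by simp [hb]
    have e1 : b (2 * p) = v ^ n * B * (v ^ n)⁻¹ := by
      simp [hb, hnp]
    rw [e0, e1, key]
  · rw [h4, h2 (4 * p + 2) 0 (by omega) (by omega)]
  · rw [h4, h1 _ le_rfl, hC']
    simp [ha, hb, hB, mul_assoc]

/-- The strands are antiparallel, and the product A⁻¹ B = v of their colours is the same at every
level of the twist region, since conjugation by `v` fixes it. -/
theorem Rel.strands_ofNat {p : ℕ} {X : ℕ → H} (h : Rel (p : ℤ) X) :
    ∀ j ≤ p, X (2 * j) = ((X 0)⁻¹ * X (4 * p + 2)) ^ j * X 0 * (((X 0)⁻¹ * X (4 * p + 2)) ^ j)⁻¹ ∧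
      X (4 * p - 2 * j + 2) =
        ((X 0)⁻¹ * X (4 * p + 2)) ^ j * X (4 * p + 2) * (((X 0)⁻¹ * X (4 * p + 2)) ^ j)⁻¹ := by
  obtain ⟨-, h, -⟩ := (rel_ofNat_iff p X).1 h
  set A := X 0
  set B := X (4 * p + 2)
  obtain ⟨v, hv⟩ : ∃ v, v = A⁻¹ * B := ⟨_, rfl⟩
  rw [← hv]
  have eB : B = A * v := by rw [hv]; group
  intro j
  induction j with
  | zero => intro _; exact ⟨by simp [A], by simp [B]⟩
  | succ j ih =>
    intro hj
    obtain ⟨i1, i2⟩ := ih (by omega)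
    obtain ⟨g1, g2, g3, g4⟩ := h j (by omega)
    have hY : X (4 * p - 2 * j) = v ^ (j + 1) * B * (v ^ (j + 1))⁻¹ := by
      rw [g4, g3] at i2
      have : X (4 * p - 2 * j) = (X (2 * j))⁻¹ * (v ^ j * B * (v ^ j)⁻¹) * X (2 * j) := by
        rw [← i2]; group
      rw [this, i1, eB]; group
    refine ⟨?_, ?_⟩
    · rw [show 2 * (j + 1) = 2 * j + 2 by omega, g2, g1, i1, hY, eB]; group
    · rw [show 4 * p - 2 * (j + 1) + 2 = 4 * p - 2 * j by omega, hY]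

theorem Rel.strands_neg {n : ℤ} (hn : n < 0) {p : ℕ} (hp : n.natAbs = p) {X : ℕ → H}
    (h : Rel n X) :
    ∀ j ≤ p, X (2 * j) = (((X 0)⁻¹ * X (4 * p + 2)) ^ j)⁻¹ * X 0 * ((X 0)⁻¹ * X (4 * p + 2)) ^ j ∧
      X (4 * p - 2 * j + 2) =
        (((X 0)⁻¹ * X (4 * p + 2)) ^ j)⁻¹ * X (4 * p + 2) * ((X 0)⁻¹ * X (4 * p + 2)) ^ j := by
  obtain ⟨-, h, -⟩ := (rel_neg_iff n hn p hp X).1 h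
  set A := X 0
  set B := X (4 * p + 2)
  obtain ⟨v, hv⟩ : ∃ v, v = A⁻¹ * B := ⟨_, rfl⟩
  rw [← hv]
  have eB : B = A * v := by rw [hv]; group
  intro j
  induction j with
  | zero => intro _; exact ⟨by simp [A], by simp [B]⟩
  | succ j ih =>
    intro hj
    obtain ⟨i1, i2⟩ := ih (by omega)
    obtain ⟨g1, g2, g3, g4⟩ := h j (by omega)
    rw [g4] at i2
    rw [i2, i1] at g1
    have hA : X (2 * (j + 1)) = (v ^ (j + 1))⁻¹ * A * v ^ (j + 1) := by
      rw [show 2 * (j + 1) = 2 * j + 2 by omega, g2, g1, eB]; group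
    refine ⟨hA, ?_⟩
    rw [show 2 * (j + 1) = 2 * j + 2 by omega, g2] at hA
    rw [show 4 * p - 2 * (j + 1) + 2 = 4 * p - 2 * j by omega]
    rw [i2, hA] at g3
    have : X (4 * p - 2 * j) = ((v ^ (j + 1))⁻¹ * A * v ^ (j + 1)) * ((v ^ j)⁻¹ * B * v ^ j) *
      ((v ^ (j + 1))⁻¹ * A * v ^ (j + 1))⁻¹ := by rw [g3]; group
    rw [this, eB]; group

end TwistKnot

/-! ### The longitude -/

namespace TwistKnot

variable {H : Type*} [Group H]

theorem Rel.clasp {n : ℤ} {p : ℕ} (hp : n.natAbs = p) {X : ℕ → H} (h : Rel n X) :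
    X (4 * p + 2) = X (2 * p) * X 0 * (X (2 * p))⁻¹ := by
  obtain ⟨h0, -, -, -, h3, h4⟩ : X (4 * p + 4) = X 0 ∧ True ∧
    X (2 * p + 1) = X (2 * p) ∧
    X (2 * p + 2) = (X (4 * p + 2))⁻¹ * X (2 * p + 1) * X (4 * p + 2) ∧
    X (4 * p + 3) = X (4 * p + 2) ∧
    X (4 * p + 4) = (X (2 * p))⁻¹ * X (4 * p + 3) * X (2 * p) := by
    rcases lt_or_ge n 0 with hn | hn
    · obtain ⟨a, -, b⟩ := (rel_neg_iff n hn p hp X).1 h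
      exact ⟨a, trivial, b⟩
    · obtain rfl : n = p := by omega
      obtain ⟨a, -, b⟩ := (rel_ofNat_iff p X).1 h
      exact ⟨a, trivial, b⟩
  rw [h0, h3] at h4
  rw [h4]; group

theorem Rel.strand_eq {n : ℤ} {p : ℕ} (hp : n.natAbs = p) {X : ℕ → H} (h : Rel n X) :
    X (2 * p) = ((X 0)⁻¹ * X (4 * p + 2)) ^ n * X 0 * (((X 0)⁻¹ * X (4 * p + 2)) ^ n)⁻¹ := by
  rcases lt_or_ge n 0 with hn | hn
  · rw [(h.strands_neg hn hp p le_rfl).1, show n = -(p : ℤ) by omega]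
    simp
  · obtain rfl : n = p := by omega
    rw [(h.strands_ofNat p le_rfl).1]
    simp

/-- The product of the first `m` factors of the longitude. -/
def longitudeProd (n : ℤ) (X : ℕ → H) (m : ℕ) : H :=
  ((List.range m).map (longitudeTerm n X)).prod

theorem longitudeProd_succ (n : ℤ) (X : ℕ → H) (m : ℕ) :
    longitudeProd n X (m + 1) = longitudeProd n X m * longitudeTerm n X m :=
  List.prod_range_succ _ _

theorem longitudeTerm_of_twist {n : ℤ} {p : ℕ} (hp : n.natAbs = p) (X : ℕ → H) {k l : ℕ}
    (h : k + l = 4 * p + 1) (h' : k < 2 * p ∨ l < 2 * p) : longitudeTerm n X k =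
      if xor (decide (Even k)) (decide (n < 0)) then 1 else X l ^ (if n < 0 then 1 else -1 : ℤ) := by
  obtain ⟨h1, h2, h3⟩ := partner_sign_of_twist hp h h'
  rw [longitudeTerm, h1, h2, h3]

theorem longitudeTerm_of_clasp {n : ℤ} {p : ℕ} (hp : n.natAbs = p) (X : ℕ → H) {k l : ℕ}
    (h : k + l = 6 * p + 3) (h' : k = 2 * p ∨ k = 2 * p + 1 ∨ l = 2 * p ∨ l = 2 * p + 1) :
    longitudeTerm n X k = if decide (Even k) then 1 else X l := by
  obtain ⟨h1, h2, h3⟩ := partner_sign_of_clasp hp h h'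
  rw [longitudeTerm, h1, h2, h3, zpow_one]

/-- Each full twist contributes one underpass, whose factor is a conjugate of `A ^ (±1)` or `B ^
(±1)` by a power of `v`. Since B = A v, the partial products telescope. -/
theorem Rel.longitudeProd_strands {n : ℤ} {p : ℕ} (hp : n.natAbs = p) {X : ℕ → H} (h : Rel n X)
    {A B v : H} (hA : X 0 = A) (hB : X (4 * p + 2) = B) (hv : v = A⁻¹ * B) :
    longitudeProd n X (2 * p) = A ^ (-n) * v ^ (-n) ∧
    longitudeProd n X (4 * p + 2) = longitudeProd n X (2 * p + 2) * (v ^ n * B ^ (-n)) := by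
  rcases lt_or_ge n 0 with hn | hn
  · have hs := h.strands_neg hn hp
    obtain ⟨-, hr, -⟩ := (rel_neg_iff n hn p hp X).1 h
    rw [hA, hB, ← hv] at hs
    have hnp : n = -(p : ℤ) := by omega
    constructor
    · have key : ∀ j ≤ p, longitudeProd n X (2 * j) = A ^ j * v ^ j := by
        intro j
        induction j with
        | zero => intro _; simp [longitudeProd]
        | succ j ih =>
          intro hj
          have t1 := longitudeTerm_of_twist hp X (k := 2 * j) (l := 4 * p - 2 * j + 1)
            (by omega) (by omega)
          have t2 := longitudeTerm_of_twist hp X (k := 2 * j + 1) (l := 4 * p - 2 * j)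
            (by omega) (by omega)
          rw [even_decide_even (j := j) rfl] at t1
          rw [odd_decide_even (j := j) rfl] at t2
          have e := (hs j (by omega)).2
          rw [(hr j (by omega)).2.2.2] at e
          have eA : B = A * v := by rw [hv]; group
          simp only [hn, decide_true, Bool.xor_true, Bool.not_true, Bool.false_eq_true, if_false,
            if_true, zpow_one, Bool.not_false, e] at t1 t2
          rw [show 2 * (j + 1) = 2 * j + 1 + 1 by omega, longitudeProd_succ, longitudeProd_succ,
            ih (by omega), t1, t2, eA]
          group
      rw [key p le_rfl, hnp]; simp
    · have key : ∀ j ≤ p, longitudeProd n X (2 * p + 2 + 2 * j) =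
          longitudeProd n X (2 * p + 2) * ((v ^ p)⁻¹ * B ^ j * v ^ (p - j)) := by
        intro j
        induction j with
        | zero => intro _; simp
        | succ j ih =>
          intro hj
          have t1 := longitudeTerm_of_twist hp X (k := 2 * p + 2 + 2 * j)
            (l := 2 * (p - (j + 1)) + 1) (by omega) (by omega)
          have t2 := longitudeTerm_of_twist hp X (k := 2 * p + 2 + 2 * j + 1)
            (l := 2 * (p - (j + 1))) (by omega) (by omega)
          rw [even_decide_even (j := p + 1 + j) (by omega)] at t1
          rw [odd_decide_even (j := p + 1 + j) (by omega)] at t2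
          obtain ⟨i, hi⟩ : ∃ i, p - j = i + 1 := ⟨p - j - 1, by omega⟩
          have hi' : p - (j + 1) = i := by omega
          rw [hi'] at t1 t2
          have e := (hs (i + 1) (by omega)).1
          rw [show 2 * (i + 1) = 2 * i + 2 by omega, (hr i (by omega)).2.1] at e
          have eA : A = B * v⁻¹ := by rw [hv]; group
          simp only [hn, decide_true, Bool.xor_true, Bool.not_true, Bool.false_eq_true, if_false,
            if_true, zpow_one, Bool.not_false, e] at t1 t2
          rw [show 2 * p + 2 + 2 * (j + 1) = 2 * p + 2 + 2 * j + 1 + 1 by omega,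
            longitudeProd_succ, longitudeProd_succ, ih (by omega), t1, t2, eA, hi, hi']
          group
      rw [show 4 * p + 2 = 2 * p + 2 + 2 * p by omega, key p le_rfl, hnp]; simp
  · obtain rfl : n = p := by omega
    have hs := h.strands_ofNat
    rw [hA, hB, ← hv] at hs
    have hn' : ¬ (p : ℤ) < 0 := by omega
    constructor
    · have key : ∀ j ≤ p, longitudeProd p X (2 * j) = (A ^ j)⁻¹ * (v ^ j)⁻¹ := by
        intro j
        induction j with
        | zero => intro _; simp [longitudeProd]
        | succ j ih =>
          intro hj
          have t1 := longitudeTerm_of_twist hp X (k := 2 * j) (l := 4 * p - 2 * j + 1)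
            (by omega) (by omega)
          have t2 := longitudeTerm_of_twist hp X (k := 2 * j + 1) (l := 4 * p - 2 * j)
            (by omega) (by omega)
          rw [even_decide_even (j := j) rfl] at t1
          rw [odd_decide_even (j := j) rfl] at t2
          have e := (hs (j + 1) (by omega)).2
          rw [show 4 * p - 2 * (j + 1) + 2 = 4 * p - 2 * j by omega] at e
          have eA : B = A * v := by rw [hv]; group
          simp only [hn', decide_false, Bool.xor_false, if_true, Bool.false_eq_true, if_false,
            e] at t1 t2
          rw [show 2 * (j + 1) = 2 * j + 1 + 1 by omega, longitudeProd_succ, longitudeProd_succ,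
            ih (by omega), t1, t2, eA]
          group
      rw [key p le_rfl]; simp
    · have key : ∀ j ≤ p, longitudeProd p X (2 * p + 2 + 2 * j) =
          longitudeProd p X (2 * p + 2) * (v ^ p * (B ^ j)⁻¹ * (v ^ (p - j))⁻¹) := by
        intro j
        induction j with
        | zero => intro _; simp
        | succ j ih =>
          intro hj
          have t1 := longitudeTerm_of_twist hp X (k := 2 * p + 2 + 2 * j)
            (l := 2 * (p - (j + 1)) + 1) (by omega) (by omega)
          have t2 := longitudeTerm_of_twist hp X (k := 2 * p + 2 + 2 * j + 1)
            (l := 2 * (p - (j + 1))) (by omega) (by omega)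
          rw [even_decide_even (j := p + 1 + j) (by omega)] at t1
          rw [odd_decide_even (j := p + 1 + j) (by omega)] at t2
          obtain ⟨i, hi⟩ : ∃ i, p - j = i + 1 := ⟨p - j - 1, by omega⟩
          have hi' : p - (j + 1) = i := by omega
          rw [hi'] at t1 t2
          have e := (hs i (by omega)).1
          have eA : A = B * v⁻¹ := by rw [hv]; group
          simp only [hn', decide_false, Bool.xor_false, if_true, Bool.false_eq_true, if_false,
            e] at t1 t2
          rw [show 2 * p + 2 + 2 * (j + 1) = 2 * p + 2 + 2 * j + 1 + 1 by omega,
            longitudeProd_succ, longitudeProd_succ, ih (by omega), t1, t2, eA, hi, hi']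
          group
      rw [show 4 * p + 2 = 2 * p + 2 + 2 * p by omega, key p le_rfl]; simp

theorem Rel.longitudeProd_eq {n : ℤ} {X : ℕ → H} (h : Rel n X)
    {A B C v : H} (hA : X 0 = A) (hB : X (4 * n.natAbs + 2) = B) (hC : X (2 * n.natAbs) = C)
    (hv : v = A⁻¹ * B) :
    longitudeProd n X (4 * n.natAbs + 4) =
      A ^ (-n) * v ^ (-n) * B * (v ^ n * B ^ (-n)) * C := by
  obtain ⟨p, hp⟩ : ∃ p, n.natAbs = p := ⟨_, rfl⟩
  rw [hp] at hB hC ⊢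
  obtain ⟨h1, h2⟩ := h.longitudeProd_strands hp hA hB hv
  have a := longitudeTerm_of_clasp hp X (k := 2 * p) (l := 4 * p + 3) (by omega) (by omega)
  have b := longitudeTerm_of_clasp hp X (k := 2 * p + 1) (l := 4 * p + 2) (by omega) (by omega)
  have c := longitudeTerm_of_clasp hp X (l := 2 * p + 1) (k := 4 * p + 2) (by omega) (by omega)
  have d := longitudeTerm_of_clasp hp X (l := 2 * p) (k := 4 * p + 3) (by omega) (by omega)
  rw [even_decide_even (j := p) rfl, if_pos rfl] at a
  rw [odd_decide_even (j := p) rfl, if_neg (by simp)] at b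
  rw [even_decide_even (j := 2 * p + 1) (by omega), if_pos rfl] at c
  rw [odd_decide_even (j := 2 * p + 1) (by omega), if_neg (by simp)] at d
  rw [longitudeProd_succ n X (4 * p + 3), longitudeProd_succ n X (4 * p + 2), h2,
    longitudeProd_succ n X (2 * p + 1), longitudeProd_succ n X (2 * p), h1, a, b, c, d, hB, hC,
    mul_one, mul_one]

theorem writhe_eq (n : ℤ) : (twistKnot n).writhe = 2 - 2 * n := by
  -- In the abelian colouring `v` is trivial, so the longitude formula just adds exponents: -n + 1 -
  -- n + 1.
  have hr : Rel n fun _ => Multiplicative.ofAdd (1 : ℤ) := by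
    refine ⟨rfl, fun k _ => ?_⟩
    split_ifs
    · rfl
    · rw [mul_comm (_ ^ _), mul_assoc, ← zpow_add, neg_add_cancel, zpow_zero, mul_one]
  have h := (ofAdd_writhe n).trans (hr.longitudeProd_eq rfl rfl rfl rfl)
  rw [inv_mul_cancel, one_zpow, one_zpow, mul_one, one_mul, ← ofAdd_zsmul, ← ofAdd_add,
    ← ofAdd_add, ← ofAdd_add] at h
  have := Multiplicative.ofAdd.injective h
  rw [this]; simp; ring

/-- After B^(-n) is written as a conjugate of A^(-n) by C, the longitude takes the form A^(-n) Y
A^n. The clasp relation makes Y commute with A, which removes the outer powers; Y is also the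
A-conjugate of the short word on the right, hence equal to it. -/
theorem longitude_conj {A C v : H} {n : ℤ} (hv : v = A⁻¹ * (C * A * C⁻¹))
    (hC : C = v ^ n * A * (v ^ n)⁻¹) :
    A ^ (-n) * v ^ (-n) * (C * A * C⁻¹) * (v ^ n * (C * A * C⁻¹) ^ (-n)) * C * A ^ (-(2 - 2 * n)) =
      (v ^ n)⁻¹ * A * v ^ n * A⁻¹ * C * A⁻¹ ∧
    Commute A ((v ^ n)⁻¹ * A * v ^ n * A⁻¹ * C * A⁻¹) := by
  obtain ⟨w, hw⟩ : ∃ w, w = v ^ n := ⟨_, rfl⟩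
  have key := clasp_relation hv hC
  rw [zpow_neg v, ← hw]
  rw [← hw] at key hC
  obtain ⟨Y, hY⟩ : ∃ Y, Y = w⁻¹ * (C * A * C⁻¹) * w * C * A⁻¹ * A⁻¹ := ⟨_, rfl⟩
  have hC1 : w⁻¹ * C = A * w⁻¹ := by rw [hC]; group
  have hC2 : C⁻¹ * w = w * A⁻¹ := by rw [hC]; group
  have hYA : Commute A Y := by
    symm
    calc Y * A = w⁻¹ * (C * A * C⁻¹) * (w * (C * A * C⁻¹) * w⁻¹) * w * C * A⁻¹ * A⁻¹ := by
          rw [hY]; group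
      _ = (w⁻¹ * C) * (C * A * C⁻¹) * w * C * A⁻¹ * A⁻¹ := by rw [key]; group
      _ = A * Y := by rw [hC1, hY]; group
  have hYZ : Y = A * (w⁻¹ * A * w * A⁻¹ * C * A⁻¹) * A⁻¹ := by
    calc Y = (w⁻¹ * C) * A * (C⁻¹ * w) * C * A⁻¹ * A⁻¹ := by rw [hY]; group
      _ = _ := by rw [hC1, hC2]; group
  have hZ : w⁻¹ * A * w * A⁻¹ * C * A⁻¹ = Y := by
    calc _ = A⁻¹ * (A * (w⁻¹ * A * w * A⁻¹ * C * A⁻¹) * A⁻¹) * A := by group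
      _ = A⁻¹ * (Y * A) := by rw [← hYZ, mul_assoc]
      _ = Y := by rw [← hYA.eq]; group
  rw [hZ]
  refine ⟨?_, hYA⟩
  rw [conj_zpow]
  calc _ = A ^ (-n) * (Y * A ^ n) := by rw [hY]; group
    _ = Y := by rw [← (hYA.zpow_left n).eq]; group

/-- The images of the meridian and the longitude under a representation of the knot group. -/
theorem exists_generator (n : ℤ) (ρ : (twistKnot n).KnotGroup →* H) :
    ∃ A C v w : H, A = ρ (twistKnot n).meridian ∧ v = A⁻¹ * (C * A * C⁻¹) ∧ w = v ^ n ∧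
      C * w = w * A ∧ ρ (twistKnot n).longitude = w⁻¹ * A * w * A⁻¹ * C * A⁻¹ ∧
      Commute A (w⁻¹ * A * w * A⁻¹ * C * A⁻¹) := by
  have h := (isColoring_iff_rel n _).1 (SignedGaussCode.isColoring_map_gen _ ρ)
  have hl := map_longitude n ρ
  obtain ⟨X, hX⟩ : ∃ X, X = cyc fun k => ρ ((twistKnot n).gen k) := ⟨_, rfl⟩
  rw [← hX] at h hl
  obtain ⟨A, hA⟩ : ∃ A, A = X 0 := ⟨_, rfl⟩
  obtain ⟨C, hC⟩ : ∃ C, C = X (2 * n.natAbs) := ⟨_, rfl⟩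
  have hB := h.clasp rfl
  rw [← hA, ← hC] at hB
  obtain ⟨v, hv⟩ : ∃ v, v = A⁻¹ * (C * A * C⁻¹) := ⟨_, rfl⟩
  have hCv := h.strand_eq rfl
  rw [hB, ← hA, ← hC, ← hv] at hCv
  have hp := h.longitudeProd_eq hA.symm hB hC.symm hv
  rw [longitudeProd] at hp
  obtain ⟨h1, h2⟩ := longitude_conj hv hCv
  refine ⟨A, C, v, v ^ n, ?_, hv, rfl, ?_, ?_, h2⟩
  · rw [hA, hX]; rfl
  · conv_lhs => rw [hCv]
    group
  · rw [hl, hp, writhe_eq, ← hA, h1]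

/-- Together with `exists_generator` this amounts to a presentation of the knot group by two
meridians and the single relation C w = w A. -/
theorem exists_hom (n : ℤ) (A C v w : H) (hv : v = A⁻¹ * (C * A * C⁻¹)) (hw : w = v ^ n)
    (h : C * w = w * A) : ∃ ρ : (twistKnot n).KnotGroup →* H, ρ (twistKnot n).meridian = A ∧
      ρ (twistKnot n).longitude = w⁻¹ * A * w * A⁻¹ * C * A⁻¹ ∧
      Commute A (w⁻¹ * A * w * A⁻¹ * C * A⁻¹) := by
  subst hw
  have hC : C = v ^ n * A * (v ^ n)⁻¹ := by rw [← h]; group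
  obtain ⟨x, hx, hx0, hx1⟩ : ∃ x : Fin (4 * n.natAbs + 4) → H,
      Rel n (cyc x) ∧ cyc x 0 = A ∧ cyc x (2 * n.natAbs) = C := by
    rcases lt_or_ge n 0 with hn | hn
    · exact exists_rel_neg n hn _ rfl A C v hv hC
    · obtain ⟨p, rfl⟩ := Int.eq_ofNat_of_zero_le hn
      exact exists_rel_ofNat p A C v hv hC
  have hB := hx.clasp rfl
  rw [hx0, hx1] at hB
  have hp := hx.longitudeProd_eq hx0 hB hx1 hv
  obtain ⟨h1, h2⟩ := longitude_conj hv hC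
  have hcol := (isColoring_iff_rel n x).2 hx
  have e : (fun k => hcol.toHom ((twistKnot n).gen k)) = x := funext hcol.toHom_gen
  refine ⟨hcol.toHom, ?_, ?_, h2⟩
  · rw [← hx0]; exact hcol.toHom_gen 0
  · rw [map_longitude, e, ← h1, ← hp, hx0, writhe_eq]
    rfl

end TwistKnot

/-! ### Powers of a unimodular matrix and the polynomial `apoly` -/

namespace TwistKnot

section Sequences

variable {R S : Type*} [CommRing R] [CommRing S]

/-- Homogeneous forms in `V`, `W` that at `W = 1` are the coefficients of the powers of a matrix of
determinant `1` and trace `V + 2`. -/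
def powSeq (V W : R) : ℕ → R × R
  | 0 => (1, 0)
  | n + 1 => (W * (powSeq V W n).1 + V * (W * (powSeq V W n).2 + (powSeq V W n).1),
      W * (powSeq V W n).2 + (powSeq V W n).1)

/-- The first component of `powSeq`. -/
def powF (V W : R) (n : ℕ) : R := (powSeq V W n).1

/-- The second component of `powSeq`. -/
def powG (V W : R) (n : ℕ) : R := (powSeq V W n).2

@[simp] theorem powF_zero (V W : R) : powF V W 0 = 1 := rfl

@[simp] theorem powG_zero (V W : R) : powG V W 0 = 0 := rfl

theorem powG_succ (V W : R) (n : ℕ) : powG V W (n + 1) = W * powG V W n + powF V W n := rfl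

theorem powF_succ (V W : R) (n : ℕ) :
    powF V W (n + 1) = W * powF V W n + V * powG V W (n + 1) := rfl

theorem map_powSeq (φ : R →+* S) (V W : R) (n : ℕ) :
    φ (powF V W n) = powF (φ V) (φ W) n ∧ φ (powG V W n) = powG (φ V) (φ W) n := by
  induction n with
  | zero => simp
  | succ n ih => simp [powF_succ, powG_succ, ih]

/-- Homogeneity, of degree n for `powF` and n - 1 for `powG`; it clears the denominator of the trace
coordinate x = V / W. -/
theorem powSeq_mul (c V W : R) (n : ℕ) : powF (c * V) (c * W) n = c ^ n * powF V W n ∧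
    powG (c * V) (c * W) (n + 1) = c ^ n * powG V W (n + 1) := by
  induction n with
  | zero => simp [powG_succ]
  | succ n ih =>
    have h1 : powF (c * V) (c * W) (n + 1) = c ^ (n + 1) * powF V W (n + 1) := by
      rw [powF_succ, powF_succ, ih.1, ih.2]; ring
    refine ⟨h1, ?_⟩
    rw [powG_succ, powG_succ _ _ (n + 1), h1, ih.2]; ring

/-- The first coefficient of the `n`-th power of a matrix of determinant `1` and trace `x + 2`. -/
def zpowF (x : R) : ℤ → R
  | Int.ofNat n => powF x 1 n
  | Int.negSucc k => powF x 1 k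

/-- The second coefficient of the `n`-th power of a matrix of determinant `1` and trace `x + 2`. -/
def zpowG (x : R) : ℤ → R
  | Int.ofNat n => powG x 1 n
  | Int.negSucc k => -powG x 1 (k + 1)

theorem pow_eq_powSeq {A : Type*} [Ring A] [Algebra R A] {x : R} {v : A}
    (hv : v * v = (x + 2) • v - 1) (n : ℕ) :
    v ^ n = powF x 1 n • (1 : A) + powG x 1 n • (v - (1 + x) • (1 : A)) := by
  induction n with
  | zero => simp
  | succ n ih =>
    rw [pow_succ, ih, powF_succ, powG_succ, add_mul, smul_mul_assoc, smul_mul_assoc, sub_mul,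
      smul_mul_assoc, one_mul, hv]
    module

open Matrix in
theorem coe_zpow_specialLinearGroup (v : SpecialLinearGroup (Fin 2) R) {x : R}
    (hx : v 0 0 + v 1 1 = x + 2) (n : ℤ) :
    ((v ^ n : SpecialLinearGroup (Fin 2) R) : Matrix (Fin 2) (Fin 2) R) =
      zpowF x n • (1 : Matrix (Fin 2) (Fin 2) R) +
        zpowG x n • ((v : Matrix (Fin 2) (Fin 2) R) - (1 + x) • (1 : Matrix (Fin 2) (Fin 2) R)) := by
  have cayley : ∀ u : SpecialLinearGroup (Fin 2) R, u 0 0 + u 1 1 = x + 2 →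
      (u : Matrix (Fin 2) (Fin 2) R) * u = (x + 2) • (u : Matrix (Fin 2) (Fin 2) R) - 1 := by
    intro u hu
    have hd := u.det_coe
    rw [det_fin_two] at hd
    rw [← hu]
    ext i j
    fin_cases i <;> fin_cases j <;> simp [mul_apply, Fin.sum_univ_two] <;>
      first | (ring; done) | linear_combination -hd
  cases n with
  | ofNat n =>
    rw [Int.ofNat_eq_natCast, zpow_natCast]
    exact (Matrix.SpecialLinearGroup.coe_pow v n).trans (pow_eq_powSeq (cayley v hx) n)
  | negSucc k =>
    -- The inverse has the same trace, so the formula for natural powers applies to it; rewriting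
    -- v⁻¹ as tr v - v shifts the index of `powF` by one and changes the sign of `powG`.
    have hi : ((v⁻¹ : SpecialLinearGroup (Fin 2) R) : Matrix (Fin 2) (Fin 2) R) =
        (x + 2) • 1 - (v : Matrix (Fin 2) (Fin 2) R) := by
      rw [SpecialLinearGroup.SL2_inv_expl, ← hx]
      ext i j
      fin_cases i <;> fin_cases j <;> simp
    have ht : (v⁻¹ : SpecialLinearGroup (Fin 2) R) 0 0 + (v⁻¹ : SpecialLinearGroup (Fin 2) R) 1 1 =
        x + 2 := by
      rw [SpecialLinearGroup.SL2_inv_expl, ← hx]; simp [add_comm]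
    rw [zpow_negSucc, ← inv_pow]
    refine (Matrix.SpecialLinearGroup.coe_pow v⁻¹ (k + 1)).trans ?_
    rw [pow_eq_powSeq (cayley _ ht), hi, powF_succ]
    simp only [zpowF, zpowG]
    module

end Sequences

section Polynomial

variable {R S : Type*} [CommRing R] [CommRing S]

/-- The polynomial expression of the A-polynomial of the twist knot. -/
def apoly (n : ℤ) (L M : R) : R :=
  match n with
  | Int.ofNat n =>
    -(powF ((1 - M ^ 2) ^ 2 * ((L - 1) * (L * M ^ 4 - 1))) (M ^ 2 * (1 + L * M ^ 2) ^ 2) n +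
      (1 + L * M ^ 2) * ((1 - M ^ 2) * (L * M ^ 4 - 1)) *
      powG ((1 - M ^ 2) ^ 2 * ((L - 1) * (L * M ^ 4 - 1))) (M ^ 2 * (1 + L * M ^ 2) ^ 2) n)
  | Int.negSucc k =>
    M ^ 2 * (1 + L * M ^ 2) *
      powF ((1 - M ^ 2) ^ 2 * ((L - 1) * (L * M ^ 4 - 1))) (M ^ 2 * (1 + L * M ^ 2) ^ 2) k -
      (1 - M ^ 2) * (L * M ^ 4 - 1) *
      powG ((1 - M ^ 2) ^ 2 * ((L - 1) * (L * M ^ 4 - 1))) (M ^ 2 * (1 + L * M ^ 2) ^ 2) (k + 1)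

theorem map_apoly (φ : R →+* S) (n : ℤ) (L M : R) : φ (apoly n L M) = apoly n (φ L) (φ M) := by
  cases n <;> simp [apoly, map_powSeq]

end Polynomial

section Field

variable {K : Type*} [Field K]

/-- The hypothesis says V = W x, so homogeneity extracts W^n from `powF` but only W^(n-1) from
`powG`; the factor M² (1 + L M²) supplies the missing W. -/
theorem mul_apoly_ofNat (n : ℕ) {L M x : K}
    (hx : M ^ 2 * (1 + L * M ^ 2) ^ 2 * x = (1 - M ^ 2) ^ 2 * ((L - 1) * (L * M ^ 4 - 1))) :
    M ^ 2 * (1 + L * M ^ 2) * apoly n L M = -(M ^ 2 * (1 + L * M ^ 2) ^ 2) ^ n *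
      (M ^ 2 * (1 + L * M ^ 2) * zpowF x n + (1 - M ^ 2) * (L * M ^ 4 - 1) * zpowG x n) := by
  change M ^ 2 * (1 + L * M ^ 2) * apoly (Int.ofNat n) L M = _ *
    (_ * zpowF x (Int.ofNat n) + _ * zpowG x (Int.ofNat n))
  simp only [apoly, zpowF, zpowG, ← hx]
  cases n with
  | zero => simp
  | succ n =>
    have h := powSeq_mul (M ^ 2 * (1 + L * M ^ 2) ^ 2) x 1 n
    have h' := powSeq_mul (M ^ 2 * (1 + L * M ^ 2) ^ 2) x 1 (n + 1)
    rw [mul_one] at h h'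
    rw [h.2, h'.1]
    ring

theorem apoly_negSucc (k : ℕ) {L M x : K}
    (hx : M ^ 2 * (1 + L * M ^ 2) ^ 2 * x = (1 - M ^ 2) ^ 2 * ((L - 1) * (L * M ^ 4 - 1))) :
    apoly (Int.negSucc k) L M = (M ^ 2 * (1 + L * M ^ 2) ^ 2) ^ k *
      (M ^ 2 * (1 + L * M ^ 2) * zpowF x (Int.negSucc k) +
        (1 - M ^ 2) * (L * M ^ 4 - 1) * zpowG x (Int.negSucc k)) := by
  simp only [apoly, zpowF, zpowG, ← hx]
  have h := powSeq_mul (M ^ 2 * (1 + L * M ^ 2) ^ 2) x 1 k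
  rw [mul_one] at h
  rw [h.1, h.2]
  ring

theorem apoly_eq_zero_iff (n : ℤ) {L M x : K} (hM : M ≠ 0) (hD : 1 + L * M ^ 2 ≠ 0)
    (hx : M ^ 2 * (1 + L * M ^ 2) ^ 2 * x = (1 - M ^ 2) ^ 2 * ((L - 1) * (L * M ^ 4 - 1))) :
    apoly n L M = 0 ↔
      M ^ 2 * (1 + L * M ^ 2) * zpowF x n + (1 - M ^ 2) * (L * M ^ 4 - 1) * zpowG x n = 0 := by
  have hW : M ^ 2 * (1 + L * M ^ 2) ^ 2 ≠ 0 := by positivity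
  have hE : M ^ 2 * (1 + L * M ^ 2) ≠ 0 := by positivity
  cases n with
  | ofNat n =>
    have h := mul_apoly_ofNat n hx
    rw [Int.ofNat_eq_natCast, ← mul_eq_zero_iff_left hE, h, neg_mul,
      neg_eq_zero, mul_eq_zero, or_iff_right (pow_ne_zero _ hW)]
  | negSucc k =>
    rw [apoly_negSucc k hx, mul_eq_zero, or_iff_right (pow_ne_zero _ hW)]

end Field

end TwistKnot

/-! ### The Riley equation in terms of matrix entries -/

namespace TwistKnot

open Matrix

section Scalars

variable {K : Type*} [Field K]

theorem mul_trace_sub_two {L M m p q r s x : K} (hMm : M * m = 1)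
    (det : p * s - q * r = 1) (hp : p = L * M ^ 2 * s) (hs : s * (1 + L * M ^ 2) = M + m)
    (hx : x = -(M - m) ^ 2 * (q * r)) :
    M ^ 2 * (1 + L * M ^ 2) ^ 2 * x = (1 - M ^ 2) ^ 2 * ((L - 1) * (L * M ^ 4 - 1)) := by
  have h1 : (1 + L * M ^ 2) ^ 2 * (q * r) = -((L - 1) * (L * M ^ 4 - 1)) := by
    linear_combination -(1 + L * M ^ 2) ^ 2 * det + (1 + L * M ^ 2) ^ 2 * s * hp +
      L * M ^ 2 * (s * (1 + L * M ^ 2) + M + m) * hs + L * (2 * M ^ 2 + M * m + 1) * hMm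
  have h2 : (M * (M - m)) ^ 2 = (1 - M ^ 2) ^ 2 := by
    linear_combination -(2 * M ^ 2 - M * m - 1) * hMm
  rw [hx]
  linear_combination -(M * (M - m)) ^ 2 * h1 + (L - 1) * (L * M ^ 4 - 1) * h2

theorem apoly_of_entries (n : ℤ) {L M m p q r s x f g α β γ δ : K} (hMm : M * m = 1)
    (det : p * s - q * r = 1) (tr : p + s = M + m) (hp : p = L * M ^ 2 * s)
    (hx : x = -(M - m) ^ 2 * (q * r)) (hf : f = zpowF x n) (hg : g = zpowG x n)
    (hα : α = f + g * (p * s - m ^ 2 * (q * r) - 1 - x)) (hβ : β = g * (p * q * (m ^ 2 - 1)))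
    (hγ : γ = g * (r * s * (M ^ 2 - 1))) (hdet : α * δ - β * γ = 1)
    (rel : p * α + q * γ = M * α) : (L - 1) * apoly n L M = 0 := by
  have hM : M ≠ 0 := left_ne_zero_of_mul_eq_one hMm
  have hs : s * (1 + L * M ^ 2) = M + m := by linear_combination tr - hp
  -- Here `C` has the same diagonal as `A`; this lies over the abelian line L = 1.
  by_cases hpM : p = M
  · have hsm : s = m := by linear_combination tr - hpM
    have : L = 1 := by
      have : M * (L - 1) = 0 := by
        linear_combination -hp + hpM - L * M ^ 2 * hsm - L * M * hMm
      rcases mul_eq_zero.1 this with h | h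
      · exact absurd h hM
      · exact sub_eq_zero.1 h
    rw [this]; ring
  -- If one off-diagonal entry of `C` vanishes, the relation forces p = M, which has been excluded.
  by_cases hqr : q * r = 0
  · exfalso
    have hbc : β * γ = 0 := by
      rw [hβ, hγ]; linear_combination g ^ 2 * p * s * (m ^ 2 - 1) * (M ^ 2 - 1) * hqr
    have hα0 : α ≠ 0 := by
      rintro rfl
      rw [hbc] at hdet
      simp at hdet
    have hqc : q * γ = 0 := by
      rw [hγ]; linear_combination g * s * (M ^ 2 - 1) * hqr
    have : (p - M) * α = 0 := by linear_combination rel - hqc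
    rcases mul_eq_zero.1 this with h | h
    · exact hpM (sub_eq_zero.1 h)
    · exact hα0 h
  have hu : q * r = -((p - M) * (p - m)) := by
    linear_combination -det + p * tr + hMm
  -- Because q r = -(p - M)(p - m), the upper left entry of the relation is divisible by p - M; the
  -- quotient is the Riley equation.
  have riley : f + g * (1 - M ^ 2 + (M - m) * s) = 0 := by
    have : (p - M) * (f + g * (1 - M ^ 2 + (M - m) * s)) = 0 := by
      rw [hα, hγ, hx] at rel
      linear_combination rel - g * s * (M ^ 2 - 1) * hu +
        (p - M) * g * ((M ^ 2 - 2) * det + (2 * q * r - s * M) * hMm)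
    rcases mul_eq_zero.1 this with h | h
    · exact absurd (sub_eq_zero.1 h) hpM
    · exact h
  -- Then the trace M + m vanishes, so M² = -1 and again L = 1.
  by_cases hD : 1 + L * M ^ 2 = 0
  · have h1 : M + m = 0 := by rw [← hs, hD, mul_zero]
    have h2 : M ^ 2 = -1 := by linear_combination M * h1 - hMm
    have : L - 1 = 0 := by linear_combination -hD + L * h2
    rw [this, zero_mul]
  rw [mul_eq_zero]
  right
  rw [apoly_eq_zero_iff n hM hD (x := x), ← hf, ← hg]
  · linear_combination M ^ 2 * (1 + L * M ^ 2) * riley - g * M ^ 2 * (M - m) * hs +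
      g * (M * m + 1) * hMm
  · exact mul_trace_sub_two hMm det hp hs hx

theorem entries_of_apoly (n : ℤ) {L M m p q r s x f g α β γ δ : K} (hMm : M * m = 1)
    (hD : 1 + L * M ^ 2 ≠ 0) (det : p * s - q * r = 1) (tr : p + s = M + m)
    (hp : p = L * M ^ 2 * s) (hq : q = -(p - M)) (hr : r = p - m)
    (hx : x = -(M - m) ^ 2 * (q * r)) (hf : f = zpowF x n) (hg : g = zpowG x n)
    (hα : α = f + g * (p * s - m ^ 2 * (q * r) - 1 - x)) (hβ : β = g * (p * q * (m ^ 2 - 1)))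
    (hγ : γ = g * (r * s * (M ^ 2 - 1))) (hδ : δ = f + g * (p * s - M ^ 2 * (q * r) - 1 - x))
    (h : apoly n L M = 0) :
    p * α + q * γ = M * α ∧ p * β + q * δ = m * β ∧ r * α + s * γ = M * γ ∧
      r * β + s * δ = m * δ := by
  have hM : M ≠ 0 := left_ne_zero_of_mul_eq_one hMm
  have hs : s * (1 + L * M ^ 2) = M + m := by linear_combination tr - hp
  rw [apoly_eq_zero_iff n hM hD (mul_trace_sub_two hMm det hp hs hx), ← hf, ← hg] at h
  have riley : f + g * (1 - M ^ 2 + (M - m) * s) = 0 := by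
    have : M ^ 2 * (1 + L * M ^ 2) * (f + g * (1 - M ^ 2 + (M - m) * s)) = 0 := by
      linear_combination h + g * M ^ 2 * (M - m) * hs - g * (M * m + 1) * hMm
    exact (mul_eq_zero.1 this).resolve_left (mul_ne_zero (pow_ne_zero 2 hM) hD)
  have hf' : f = -g * (1 - M ^ 2 + (M - m) * s) := by linear_combination riley
  have hs' : s = M + m - p := by linear_combination tr
  have hm : m = M⁻¹ := eq_inv_of_mul_eq_one_right hMm
  subst hα hβ hγ hδ hx
  rw [hf', hq, hr, hs', hm]
  clear * - hM
  refine ⟨?_, ?_, ?_, ?_⟩ <;> field_simp <;> ring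

end Scalars

end TwistKnot

/-! ### From representations to zeros of `apoly` and back -/

namespace TwistKnot

open Matrix

section Representations

variable {K : Type*} [Field K]

theorem SL2_mul_apply (A B : SpecialLinearGroup (Fin 2) K) (i j : Fin 2) :
    (A * B) i j = A i 0 * B 0 j + A i 1 * B 1 j := by
  simp [mul_apply, Fin.sum_univ_two]

theorem SL2_inv_apply (A : SpecialLinearGroup (Fin 2) K) :
    A⁻¹ 0 0 = A 1 1 ∧ A⁻¹ 0 1 = -A 0 1 ∧ A⁻¹ 1 0 = -A 1 0 ∧ A⁻¹ 1 1 = A 0 0 := by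
  rw [SpecialLinearGroup.SL2_inv_expl]
  exact ⟨rfl, rfl, rfl, rfl⟩

theorem SL2_det (A : SpecialLinearGroup (Fin 2) K) : A 0 0 * A 1 1 - A 0 1 * A 1 0 = 1 :=
  (det_fin_two _).symm.trans A.det_coe

/-- The entries of `A⁻¹ * (C * A * C⁻¹)` for a diagonal matrix `A`. -/
theorem commutator_apply {A C v : SpecialLinearGroup (Fin 2) K} {M m : K}
    (hv : v = A⁻¹ * (C * A * C⁻¹)) (h01 : A 0 1 = 0) (h10 : A 1 0 = 0) (hM : A 0 0 = M)
    (hm : A 1 1 = m) (hMm : M * m = 1) :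
    v 0 0 = C 0 0 * C 1 1 - m ^ 2 * (C 0 1 * C 1 0) ∧ v 0 1 = C 0 0 * C 0 1 * (m ^ 2 - 1) ∧
    v 1 0 = C 1 0 * C 1 1 * (M ^ 2 - 1) ∧ v 1 1 = C 0 0 * C 1 1 - M ^ 2 * (C 0 1 * C 1 0) := by
  refine ⟨?_, ?_, ?_, ?_⟩ <;> rw [hv] <;> simp only [SL2_mul_apply, SL2_inv_apply, h01, h10, hM, hm]
  · linear_combination (C 0 0 * C 1 1) * hMm
  · linear_combination -(C 0 0 * C 0 1) * hMm
  · linear_combination -(C 1 0 * C 1 1) * hMm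
  · linear_combination (C 0 0 * C 1 1) * hMm

/-- The entries of the powers of `A⁻¹ * (C * A * C⁻¹)` for a diagonal matrix `A`. -/
theorem zpow_commutator_apply {A C v w : SpecialLinearGroup (Fin 2) K} {M m x : K} {n : ℤ}
    (hv : v = A⁻¹ * (C * A * C⁻¹)) (hw : w = v ^ n) (h01 : A 0 1 = 0) (h10 : A 1 0 = 0)
    (hM : A 0 0 = M) (hm : A 1 1 = m) (hMm : M * m = 1)
    (hx : x = -(M - m) ^ 2 * (C 0 1 * C 1 0)) :
    w 0 0 = zpowF x n + zpowG x n * (C 0 0 * C 1 1 - m ^ 2 * (C 0 1 * C 1 0) - 1 - x) ∧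
    w 0 1 = zpowG x n * (C 0 0 * C 0 1 * (m ^ 2 - 1)) ∧
    w 1 0 = zpowG x n * (C 1 0 * C 1 1 * (M ^ 2 - 1)) ∧
    w 1 1 = zpowF x n + zpowG x n * (C 0 0 * C 1 1 - M ^ 2 * (C 0 1 * C 1 0) - 1 - x) := by
  obtain ⟨v00, v01, v10, v11⟩ := commutator_apply hv h01 h10 hM hm hMm
  have htr : v 0 0 + v 1 1 = x + 2 := by
    rw [v00, v11, hx]
    linear_combination 2 * SL2_det C - 2 * (C 0 1 * C 1 0) * hMm
  have hpow := coe_zpow_specialLinearGroup v htr n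
  rw [← hw] at hpow
  rw [← v00, ← v01, ← v10, ← v11]
  refine ⟨?_, ?_, ?_, ?_⟩
  · refine (congrFun (congrFun hpow 0) 0).trans ?_
    simp
    left
    ring
  · refine (congrFun (congrFun hpow 0) 1).trans ?_
    simp
  · refine (congrFun (congrFun hpow 1) 0).trans ?_
    simp
  · refine (congrFun (congrFun hpow 1) 1).trans ?_
    simp
    left
    ring

theorem apoly_of_diagonal (n : ℤ) {A C v w l : SpecialLinearGroup (Fin 2) K} {L M : K}
    (hv : v = A⁻¹ * (C * A * C⁻¹)) (hw : w = v ^ n) (hCw : C * w = w * A)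
    (hl : l = w⁻¹ * A * w * A⁻¹ * C * A⁻¹) (hcomm : Commute A l)
    (h01 : A 0 1 = 0) (h10 : A 1 0 = 0) (hM : A 0 0 = M) (hM2 : M ^ 2 ≠ 1)
    (hL : l 0 0 = L) : (L - 1) * apoly n L M = 0 := by
  obtain ⟨m, hm⟩ : ∃ m, A 1 1 = m := ⟨_, rfl⟩
  have hMm : M * m = 1 := by
    have := SL2_det A
    rw [h01, hM, hm] at this
    linear_combination this
  have det := SL2_det C
  have detw := SL2_det w
  have hMm' : M - m ≠ 0 := by
    intro h
    apply hM2
    linear_combination M * h + hMm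
  have hCe : C = w * A * w⁻¹ := by rw [← hCw]; group
  have hC00 : C 0 0 = M * (w 0 0 * w 1 1) - m * (w 0 1 * w 1 0) := by
    rw [hCe]
    simp only [SL2_mul_apply, SL2_inv_apply, h01, h10, hM, hm]
    ring
  have hC11 : C 1 1 = m * (w 0 0 * w 1 1) - M * (w 0 1 * w 1 0) := by
    rw [hCe]
    simp only [SL2_mul_apply, SL2_inv_apply, h01, h10, hM, hm]
    ring
  have hl01 : l 0 1 = 0 := by
    have := congrArg (fun u : SpecialLinearGroup (Fin 2) K => u 0 1) hcomm.eq
    simp only [SL2_mul_apply, h01, hM, hm] at this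
    have : (M - m) * l 0 1 = 0 := by linear_combination this
    exact (mul_eq_zero.1 this).resolve_left hMm'
  -- As A is diagonal, w⁻¹ A w has the same upper left entry as w A w⁻¹ = C. Solving the longitude
  -- word for w⁻¹ A w expresses that entry through L and C⁻¹.
  have hp : C 0 0 = L * M ^ 2 * C 1 1 := by
    have e : w⁻¹ * A * w = l * A * C⁻¹ * A := by rw [hl]; group
    have := congrArg (fun u : SpecialLinearGroup (Fin 2) K => u 0 0) e
    simp only [SL2_mul_apply, SL2_inv_apply, h01, h10, hM, hm, hL, hl01] at this
    rw [hC00]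
    linear_combination this
  obtain ⟨x, hx⟩ : ∃ x, x = -(M - m) ^ 2 * (C 0 1 * C 1 0) := ⟨_, rfl⟩
  obtain ⟨w00, w01, w10, -⟩ := zpow_commutator_apply hv hw h01 h10 hM hm hMm hx
  have rel := congrArg (fun u : SpecialLinearGroup (Fin 2) K => u 0 0) hCw
  simp only [SL2_mul_apply, h10, hM] at rel
  refine apoly_of_entries n (f := zpowF x n) (g := zpowG x n) hMm det ?_ hp hx rfl rfl
    (α := w 0 0) (β := w 0 1) (γ := w 1 0) (δ := w 1 1) w00 w01 w10 detw ?_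
  · rw [hC00, hC11]; linear_combination (M + m) * detw
  · linear_combination rel

/-- If M² ≠ 1 the meridian can be diagonalised. If M² = 1 it is either central, so that the
longitude is trivial, or parabolic, and then only finitely many pairs occur. -/
theorem mem_eigenvalueSet (n : ℤ) {u : Fin 2 → ℂ}
    (hu : u ∈ eigenvalueSet (twistKnot n).meridian (twistKnot n).longitude) :
    (u 0 - 1) * apoly n (u 0) (u 1) = 0 ∨ (u 1 ^ 2 = 1 ∧ u 0 ^ 2 = 1) := by
  obtain ⟨ρ, hl, hm, hL, hM⟩ := hu
  by_cases hM2 : u 1 ^ 2 = 1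
  · obtain ⟨A, C, v, w, hA, hv, hw, hCw, hlong, hcomm⟩ := exists_generator n ρ
    rw [← hlong] at hcomm
    rw [← hA] at hm hM
    obtain ⟨l, hle⟩ : ∃ l, l = ρ (twistKnot n).longitude := ⟨_, rfl⟩
    rw [← hle] at hl hL hcomm hlong
    have hM0 : u 1 ≠ 0 := by rintro h; rw [h] at hM2; simp at hM2
    have detA := SL2_det A
    have detl := SL2_det l
    rw [hm, hM] at detA
    rw [hl, hL] at detl
    have hA11 : A 1 1 = u 1 := by
      apply mul_left_cancel₀ hM0
      linear_combination detA - hM2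
    by_cases h01 : A 0 1 = 0
    · left
      have hcen : A * w = w * A := by
        ext i j
        fin_cases i <;> fin_cases j <;>
          simp [SL2_mul_apply, hm, hM, hA11, h01, mul_comm]
      have hCA : C = A := mul_right_cancel (hCw.trans hcen.symm)
      have hl1 : l = 1 := by
        rw [hlong, hCA, mul_assoc w⁻¹, hcen]; group
      rw [← hL, hl1]; simp
    -- A matrix commuting with a nontrivial parabolic has equal diagonal entries, so the determinant
    -- of the longitude gives L² = 1.
    · right
      refine ⟨hM2, ?_⟩
      have := congrArg (fun u : SpecialLinearGroup (Fin 2) ℂ => u 0 1) hcomm.eq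
      simp only [SL2_mul_apply, hM, hA11, hL] at this
      have h : A 0 1 * (l 1 1 - u 0) = 0 := by linear_combination this
      have h' : l 1 1 = u 0 := sub_eq_zero.1 ((mul_eq_zero.1 h).resolve_left h01)
      rw [h'] at detl
      linear_combination detl
  · left
    obtain ⟨A₀, hA₀⟩ : ∃ A, A = ρ (twistKnot n).meridian := ⟨_, rfl⟩
    obtain ⟨l₀, hl₀⟩ : ∃ l, l = ρ (twistKnot n).longitude := ⟨_, rfl⟩
    rw [← hA₀] at hm hM
    rw [← hl₀] at hl hL
    have detA := SL2_det A₀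
    rw [hm, hM] at detA
    have hd : u 1 - A₀ 1 1 ≠ 0 := by
      intro h
      apply hM2
      linear_combination u 1 * h + detA
    -- An upper unipotent conjugation that diagonalises the meridian; it keeps the diagonal of every
    -- upper triangular matrix, so L and M are unchanged.
    let g : SpecialLinearGroup (Fin 2) ℂ := ⟨!![1, A₀ 0 1 / (u 1 - A₀ 1 1); 0, 1], by simp⟩
    have g00 : g 0 0 = 1 := rfl
    have g01 : g 0 1 = A₀ 0 1 / (u 1 - A₀ 1 1) := rfl
    have g10 : g 1 0 = 0 := rfl
    have g11 : g 1 1 = 1 := rfl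
    obtain ⟨A, C, v, w, hA, hv, hw, hCw, hlong, hcomm⟩ :=
      exists_generator n ((MulAut.conj g).toMonoidHom.comp ρ)
    rw [← hlong] at hcomm
    have hA' : A = g * A₀ * g⁻¹ := by rw [hA, hA₀]; rfl
    have hl' : ((MulAut.conj g).toMonoidHom.comp ρ) (twistKnot n).longitude = g * l₀ * g⁻¹ := by
      rw [hl₀]; rfl
    rw [hl'] at hlong hcomm
    refine apoly_of_diagonal n hv hw hCw hlong hcomm ?_ ?_ ?_ hM2 ?_
    · rw [hA']
      simp only [SL2_mul_apply, SL2_inv_apply, hm, hM, g00, g01]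
      field_simp
      ring
    · rw [hA']
      simp [SL2_mul_apply, SL2_inv_apply, hm, g10, g11]
    · rw [hA']
      simp [SL2_mul_apply, SL2_inv_apply, hm, hM, g00, g10, g11]
    · simp [SL2_mul_apply, SL2_inv_apply, hl, hL, g00, g10, g11]

theorem mem_eigenvalueSet_of_apoly (n : ℤ) {L M : ℂ} (hM : M ≠ 0) (hM4 : M ^ 4 ≠ 1)
    (hD : 1 + L * M ^ 2 ≠ 0) (h : apoly n L M = 0) :
    ![L, M] ∈ eigenvalueSet (twistKnot n).meridian (twistKnot n).longitude := by
  obtain ⟨m, hm⟩ : ∃ m, m = M⁻¹ := ⟨_, rfl⟩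
  have hMm : M * m = 1 := by rw [hm]; exact mul_inv_cancel₀ hM
  -- The solution of p = L M² s and p + s = M + m.
  obtain ⟨s, hs⟩ : ∃ s, s = (M + m) / (1 + L * M ^ 2) := ⟨_, rfl⟩
  have hsD : s * (1 + L * M ^ 2) = M + m := by rw [hs, div_mul_cancel₀ _ hD]
  obtain ⟨p, hp⟩ : ∃ p, p = L * M ^ 2 * s := ⟨_, rfl⟩
  have tr : p + s = M + m := by linear_combination hp + hsD
  have det : p * s - -(p - M) * (p - m) = 1 := by
    linear_combination p * tr + hMm
  have hs0 : s ≠ 0 := by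
    rintro rfl
    apply hM4
    linear_combination (-M * hsD - hMm) * (M ^ 2 - 1)
  have hM2 : M - m ≠ 0 := by
    intro h'
    apply hM4
    linear_combination (M * h' + hMm) * (M ^ 2 + 1)
  let A : SpecialLinearGroup (Fin 2) ℂ := ⟨!![M, 0; 0, m], by simp [hMm]⟩
  -- The determinant prescribes only the product -(p - M)(p - m) of the off-diagonal entries; this
  -- is one way to split it.
  let C : SpecialLinearGroup (Fin 2) ℂ := ⟨!![p, -(p - M); p - m, s], by
    rw [det_fin_two_of]; exact det⟩
  obtain ⟨v, hv⟩ : ∃ v, v = A⁻¹ * (C * A * C⁻¹) := ⟨_, rfl⟩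
  obtain ⟨w, hw⟩ : ∃ w, w = v ^ n := ⟨_, rfl⟩
  obtain ⟨x, hx⟩ : ∃ x, x = -(M - m) ^ 2 * (-(p - M) * (p - m)) := ⟨_, rfl⟩
  have hM' : A 0 0 = M := rfl
  have hm' : A 1 1 = m := rfl
  have h01 : A 0 1 = 0 := rfl
  have h10 : A 1 0 = 0 := rfl
  have c00 : C 0 0 = p := rfl
  have c01 : C 0 1 = -(p - M) := rfl
  have c10 : C 1 0 = p - m := rfl
  have c11 : C 1 1 = s := rfl
  obtain ⟨w00, w01, w10, w11⟩ := zpow_commutator_apply hv hw h01 h10 hM' hm' hMm hx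
  obtain ⟨r00, r01, r10, r11⟩ := entries_of_apoly n (f := zpowF x n) (g := zpowG x n)
    (α := w 0 0) (β := w 0 1) (γ := w 1 0) (δ := w 1 1) hMm hD det tr hp rfl rfl hx rfl rfl
    w00 w01 w10 w11 h
  have hCw : C * w = w * A := by
    ext i j
    fin_cases i <;> fin_cases j <;>
      simp only [Fin.zero_eta, Fin.mk_one, SL2_mul_apply, hM', hm', h01, h10, c00, c01, c10, c11]
    · linear_combination r00
    · linear_combination r01
    · linear_combination r10
    · linear_combination r11
  obtain ⟨ρ, hρA, hρl, hcomm⟩ := exists_hom n A C v w hv hw hCw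
  obtain ⟨l, hl⟩ : ∃ l, l = w⁻¹ * A * w * A⁻¹ * C * A⁻¹ := ⟨_, rfl⟩
  rw [← hl] at hρl hcomm
  have hl01 : l 0 1 = 0 := by
    have := congrArg (fun u : SpecialLinearGroup (Fin 2) ℂ => u 0 1) hcomm.eq
    simp only [SL2_mul_apply, hM', hm', h01] at this
    have : (M - m) * l 0 1 = 0 := by linear_combination this
    exact (mul_eq_zero.1 this).resolve_left hM2
  have hl10 : l 1 0 = 0 := by
    have := congrArg (fun u : SpecialLinearGroup (Fin 2) ℂ => u 1 0) hcomm.eq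
    simp only [SL2_mul_apply, hM', hm', h10] at this
    have : (M - m) * l 1 0 = 0 := by linear_combination -this
    exact (mul_eq_zero.1 this).resolve_left hM2
  have hl00 : l 0 0 = L := by
    have hCe : C = w * A * w⁻¹ := by rw [← hCw]; group
    have e1 := congrArg (fun u : SpecialLinearGroup (Fin 2) ℂ => u 0 0) hCe
    have e : w⁻¹ * A * w = l * A * C⁻¹ * A := by rw [hl]; group
    have e2 := congrArg (fun u : SpecialLinearGroup (Fin 2) ℂ => u 0 0) e
    simp only [SL2_mul_apply, SL2_inv_apply, hM', hm', h01, h10, c00, c10, c11, hl01] at e1 e2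
    have : M ^ 2 * s * (l 0 0 - L) = 0 := by linear_combination hp - e1 - e2
    exact sub_eq_zero.1 ((mul_eq_zero.1 this).resolve_left (mul_ne_zero (pow_ne_zero 2 hM) hs0))
  refine ⟨ρ, ?_, ?_, ?_, ?_⟩
  · rw [hρl, hl10]
  · rw [hρA, h10]
  · rw [hρl, hl00]; rfl
  · rw [hρA, hM']; rfl

end Representations

end TwistKnot

/-! ### The explicit binomial formula -/

namespace TwistKnot

section ExplicitFormula

/-- Pascal's rule matches the recursion. The summation bound N is kept independent of n so that the
ranges stay fixed in the induction; the extra binomials vanish. -/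
theorem powSeq_eq_sum {R : Type*} [CommRing R] (x : R) (N n : ℕ) (hn : n ≤ N) :
    powF x 1 n = ∑ j ∈ Finset.range (N + 1), ((n + j).choose (2 * j) : R) * x ^ j ∧
    powG x 1 n = ∑ j ∈ Finset.range N, ((n + j).choose (2 * j + 1) : R) * x ^ j := by
  induction n with
  | zero =>
    constructor
    · rw [Finset.sum_range_succ', Finset.sum_eq_zero]
      · simp
      · intro j _
        rw [Nat.choose_eq_zero_of_lt (by omega)]; simp
    · rw [Finset.sum_eq_zero]
      · simp
      · intro j _
        rw [Nat.choose_eq_zero_of_lt (by omega)]; simp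
  | succ n ih =>
    obtain ⟨hF, hG⟩ := ih (by omega)
    have hG' : powG x 1 (n + 1) =
        ∑ j ∈ Finset.range N, ((n + 1 + j).choose (2 * j + 1) : R) * x ^ j := by
      rw [powG_succ, one_mul, hF, hG, Finset.sum_range_succ,
        Nat.choose_eq_zero_of_lt (show n + N < 2 * N by omega), Nat.cast_zero, zero_mul, add_zero,
        ← Finset.sum_add_distrib]
      refine Finset.sum_congr rfl fun j _ => ?_
      rw [show n + 1 + j = (n + j) + 1 by omega, Nat.choose_succ_succ' (n + j) (2 * j)]
      push_cast; ring
    refine ⟨?_, hG'⟩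
    rw [powF_succ, one_mul, hG', hF, Finset.sum_range_succ', Finset.sum_range_succ' _ N,
      Finset.mul_sum, add_right_comm, ← Finset.sum_add_distrib]
    congr 1
    · refine Finset.sum_congr rfl fun j _ => ?_
      rw [show n + 1 + (j + 1) = (n + 1 + j) + 1 by omega,
        show 2 * (j + 1) = (2 * j + 1) + 1 by omega, Nat.choose_succ_succ' (n + 1 + j) (2 * j + 1),
        show n + (j + 1) = n + 1 + j by omega]
      push_cast; ring
    · simp

theorem sum_range_two_mul {R : Type*} [AddCommMonoid R] (f : ℕ → R) (n : ℕ) :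
    ∑ i ∈ Finset.range (2 * n), f i =
      ∑ j ∈ Finset.range n, f (2 * j) + ∑ j ∈ Finset.range n, f (2 * j + 1) := by
  induction n with
  | zero => simp
  | succ n ih =>
    rw [show 2 * (n + 1) = 2 * n + 1 + 1 by omega, Finset.sum_range_succ, Finset.sum_range_succ, ih,
      Finset.sum_range_succ, Finset.sum_range_succ]
    abel

variable {K : Type*} [Field K]

theorem explicitA_eq_apoly (n : ℤ) {L M : K} (hM : M ≠ 0) (hD : 1 + L * M ^ 2 ≠ 0) :
    explicitA n L M = apoly n L M := by
  obtain ⟨x, hx⟩ : ∃ x, x = (1 - M ^ 2) ^ 2 * ((L - 1) * (L * M ^ 2 - M ^ (-2 : ℤ))) /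
    (1 + L * M ^ 2) ^ 2 := ⟨_, rfl⟩
  have hM2 : M ^ (-2 : ℤ) = (M ^ 2)⁻¹ := by rw [zpow_neg]; norm_cast
  have hxW : M ^ 2 * (1 + L * M ^ 2) ^ 2 * x =
      (1 - M ^ 2) ^ 2 * ((L - 1) * (L * M ^ 4 - 1)) := by
    rw [hx, hM2]
    clear hx
    generalize 1 + L * M ^ 2 = D at hD
    field_simp
  have term_even : ∀ (b : K), b ^ 2 = (1 - M ^ 2) ^ 2 → ∀ j : ℕ,
      b ^ (2 * j) * (1 + L * M ^ 2) ^ (-((2 * j : ℕ) : ℤ)) * (L - 1) ^ ((2 * j) / 2) *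
        (L * M ^ 2 - M ^ (-2 : ℤ)) ^ ((1 + 2 * j) / 2) = x ^ j := by
    intro b hb j
    rw [show (2 * j) / 2 = j by omega, show (1 + 2 * j) / 2 = j by omega, pow_mul, hb, zpow_neg,
      zpow_natCast, pow_mul, hx, div_pow, mul_pow, mul_pow, div_eq_mul_inv]
    ring
  have term_odd : ∀ (b : K), b ^ 2 = (1 - M ^ 2) ^ 2 → ∀ j : ℕ,
      b ^ (2 * j + 1) * (1 + L * M ^ 2) ^ (-((2 * j + 1 : ℕ) : ℤ)) * (L - 1) ^ ((2 * j + 1) / 2) *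
        (L * M ^ 2 - M ^ (-2 : ℤ)) ^ ((1 + (2 * j + 1)) / 2) =
      (b * (L * M ^ 2 - M ^ (-2 : ℤ)) / (1 + L * M ^ 2)) * x ^ j := by
    intro b hb j
    rw [show (2 * j + 1) / 2 = j by omega, show (1 + (2 * j + 1)) / 2 = j + 1 by omega, pow_succ b,
      pow_mul, hb, zpow_neg, zpow_natCast, pow_succ (1 + L * M ^ 2), pow_mul, hx, div_pow, mul_pow,
      mul_pow, div_eq_mul_inv, div_eq_mul_inv, mul_inv, pow_succ (L * M ^ 2 - _)]
    ring
  rcases lt_or_ge n 0 with hn | hn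
  · obtain ⟨k, rfl⟩ := Int.eq_negSucc_of_lt_zero hn
    rw [apoly_negSucc k hxW, explicitA, if_neg (by omega)]
    rw [show (-2 * Int.negSucc k - 1).toNat + 1 = 2 * (k + 1) by omega,
      show -2 * Int.negSucc k - 1 = ((2 * k + 1 : ℕ) : ℤ) by omega,
      show -2 * Int.negSucc k = ((2 * k + 2 : ℕ) : ℤ) by omega, sum_range_two_mul]
    -- Integer division rounds down, so (2j - 1) / 2 is j - 1 even for j = 0; even indices therefore
    -- give `powF` at k and odd ones `powG` at k + 1.
    have e1 : ∀ j : ℕ, (-Int.negSucc k + (((2 * j : ℕ) : ℤ) - 1) / 2).toNat = k + j := by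
      intro j; omega
    have e2 : ∀ j : ℕ, (-Int.negSucc k + (((2 * j + 1 : ℕ) : ℤ) - 1) / 2).toNat = k + 1 + j := by
      intro j; omega
    have h1 := fun j => term_even (M ^ 2 - 1) (by ring) j
    have h2 := fun j => term_odd (M ^ 2 - 1) (by ring) j
    simp only [e1, e2, mul_assoc] at h1 h2 ⊢
    simp only [h1, h2]
    have s1 := (powSeq_eq_sum x k k le_rfl).1
    have s2 := (powSeq_eq_sum x (k + 1) (k + 1) le_rfl).2
    simp only [zpowF, zpowG]
    rw [s1, s2, zpow_natCast, zpow_natCast, hM2]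
    simp only [mul_left_comm _ (_ / _) _, ← Finset.mul_sum]
    clear s1 s2 h1 h2 e1 e2 term_even term_odd hxW hx
    generalize (∑ j ∈ Finset.range _, _ : K) = S₁
    generalize (∑ j ∈ Finset.range _, _ : K) = S₂
    rw [show L * M ^ 4 - 1 = M ^ 2 * (L * M ^ 2 - (M ^ 2)⁻¹) by field_simp]
    generalize 1 + L * M ^ 2 = D at *
    generalize L * M ^ 2 - (M ^ 2)⁻¹ = Y
    rw [mul_pow (M ^ 2), ← pow_mul, ← pow_mul]
    field_simp
    ring
  · obtain ⟨k, rfl⟩ := Int.eq_ofNat_of_zero_le hn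
    have hE : M ^ 2 * (1 + L * M ^ 2) ≠ 0 := mul_ne_zero (pow_ne_zero 2 hM) hD
    apply mul_left_cancel₀ hE
    rw [mul_apoly_ofNat k hxW, explicitA, if_pos hn,
      show (2 * (k : ℤ)).toNat + 1 = 2 * k + 1 by omega, Finset.sum_range_succ, sum_range_two_mul,
      add_right_comm, ← Finset.sum_range_succ (fun j => _ * _ ^ (2 * j) * _ * _ * _),
      show 2 * (k : ℤ) = ((2 * k : ℕ) : ℤ) by omega]
    have e1 : ∀ j : ℕ, ((k : ℤ) + ((2 * j : ℕ) : ℤ) / 2).toNat = k + j := by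
      intro j; omega
    have e2 : ∀ j : ℕ, ((k : ℤ) + ((2 * j + 1 : ℕ) : ℤ) / 2).toNat = k + j := by
      intro j; omega
    have h1 := fun j => term_even (1 - M ^ 2) rfl j
    have h2 := fun j => term_odd (1 - M ^ 2) rfl j
    simp only [e1, e2, mul_assoc] at h1 h2 ⊢
    simp only [h1, h2]
    obtain ⟨s1, s2⟩ := powSeq_eq_sum x k k le_rfl
    change _ = _ * (_ * (_ * powF x 1 k) + _ * (_ * powG x 1 k))
    rw [s1, s2, zpow_natCast, zpow_natCast, hM2]
    simp only [mul_left_comm _ (_ / _) _, ← Finset.mul_sum]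
    clear s1 s2 h1 h2 e1 e2 term_even term_odd hxW hx
    generalize (∑ j ∈ Finset.range _, _ : K) = S₁
    generalize (∑ j ∈ Finset.range _, _ : K) = S₂
    rw [show L * M ^ 4 - 1 = M ^ 2 * (L * M ^ 2 - (M ^ 2)⁻¹) by field_simp]
    generalize 1 + L * M ^ 2 = D at *
    generalize L * M ^ 2 - (M ^ 2)⁻¹ = Y
    rw [mul_pow (M ^ 2), ← pow_mul, ← pow_mul]
    field_simp

end ExplicitFormula

end TwistKnot

/-! ### Counting the roots in L for a fixed generic M -/

namespace Polynomial

open TwistKnot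

section Degree

theorem natDegree_powSeq_le {R : Type*} [CommRing R] {V W : R[X]} (hV : V.natDegree ≤ 2)
    (hW : W.natDegree ≤ 2) (n : ℕ) :
    (powF V W n).natDegree ≤ 2 * n ∧ (powG V W (n + 1)).natDegree ≤ 2 * n := by
  have hmul : ∀ {p q : R[X]} {a b c : ℕ}, p.natDegree ≤ a → q.natDegree ≤ b → a + b ≤ c →
      (p * q).natDegree ≤ c := fun hp hq h =>
    natDegree_mul_le.trans ((add_le_add hp hq).trans h)
  induction n with
  | zero => simp [powG_succ]
  | succ n ih =>
    have h1 : (powF V W (n + 1)).natDegree ≤ 2 * (n + 1) := by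
      rw [powF_succ]
      exact natDegree_add_le_of_degree_le (hmul hW ih.1 (by omega)) (hmul hV ih.2 (by omega))
    refine ⟨h1, ?_⟩
    rw [powG_succ]
    exact natDegree_add_le_of_degree_le (hmul hW ih.2 (by omega)) h1

/-- The degree of `apoly n L M` in `L`. -/
def apolyDegree : ℤ → ℕ
  | Int.ofNat n => 2 * n
  | Int.negSucc k => 2 * k + 1

theorem natDegree_apoly_le {R : Type*} [CommRing R] (n : ℤ) (M : R) :
    (apoly n X (C M)).natDegree ≤ apolyDegree n := by
  have hmul : ∀ {p q : R[X]} {a b c : ℕ}, p.natDegree ≤ a → q.natDegree ≤ b → a + b ≤ c →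
      (p * q).natDegree ≤ c := fun hp hq h =>
    natDegree_mul_le.trans ((add_le_add hp hq).trans h)
  have hD : (1 + X * C M ^ 2 : R[X]).natDegree ≤ 1 := by compute_degree
  have hU : ((1 - C M ^ 2) * (X * C M ^ 4 - 1) : R[X]).natDegree ≤ 1 := by compute_degree
  have hV : ((1 - C M ^ 2) ^ 2 * ((X - 1) * (X * C M ^ 4 - 1)) : R[X]).natDegree ≤ 2 := by
    compute_degree
  have hW : (C M ^ 2 * (1 + X * C M ^ 2) ^ 2 : R[X]).natDegree ≤ 2 := by compute_degree
  have hM : (C M ^ 2 : R[X]).natDegree ≤ 0 := by compute_degree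
  have key := natDegree_powSeq_le hV hW
  cases n with
  | ofNat n =>
    simp only [apoly, apolyDegree, natDegree_neg]
    refine natDegree_add_le_of_degree_le (key n).1 ?_
    cases n with
    | zero => simp
    | succ n => exact hmul (hmul hD hU le_rfl) (key n).2 (by omega)
  | negSucc k =>
    simp only [apoly, apolyDegree]
    rw [← max_self (2 * k + 1)]
    exact natDegree_sub_le_of_le (hmul (hmul hM hD le_rfl) (key k).1 (by omega))
      (hmul hU (key k).2 (by omega))

theorem monic_powSeq {R : Type*} [CommRing R] [Nontrivial R] (n : ℕ) :
    ((powF (X : R[X]) 1 n).Monic ∧ (powF (X : R[X]) 1 n).natDegree = n) ∧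
    ((powG (X : R[X]) 1 (n + 1)).Monic ∧ (powG (X : R[X]) 1 (n + 1)).natDegree = n) := by
  induction n with
  | zero => simp [powG_succ]
  | succ n ih =>
    obtain ⟨⟨f1, f2⟩, g1, g2⟩ := ih
    have hX : ((X : R[X]) * powG (X : R[X]) 1 (n + 1)).Monic := monic_X.mul g1
    have hXd : ((X : R[X]) * powG (X : R[X]) 1 (n + 1)).natDegree = n + 1 := by
      rw [monic_X.natDegree_mul g1, g2, natDegree_X, add_comm]
    have hlt : ∀ {p q : R[X]}, p.Monic → q.Monic → p.natDegree < q.natDegree →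
        (p + q).Monic ∧ (p + q).natDegree = q.natDegree := fun {p q} hp hq h =>
      have h' : p.degree < q.degree := degree_lt_degree h
      ⟨hq.add_of_right h', natDegree_add_eq_right_of_natDegree_lt h⟩
    have hF : (powF (X : R[X]) 1 (n + 1)).Monic ∧ (powF (X : R[X]) 1 (n + 1)).natDegree = n + 1 := by
      rw [powF_succ, one_mul]
      have := hlt f1 hX (by omega)
      exact ⟨this.1, this.2.trans hXd⟩
    refine ⟨hF, ?_⟩
    rw [powG_succ, one_mul]
    have := hlt g1 hF.1 (by omega)
    exact ⟨this.1, this.2.trans hF.2⟩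

theorem zpowF_mul_zpowG {K : Type*} [Field K] {n : ℤ} (hn : n ≠ 0) :
    zpowF (X : K[X]) n * zpowG X n ≠ 0 ∧
      (zpowF (X : K[X]) n * zpowG X n).natDegree + 1 = apolyDegree n := by
  cases n with
  | ofNat n =>
    obtain _ | n := n
    · exact absurd rfl hn
    · obtain ⟨⟨f1, f2⟩, -⟩ := monic_powSeq (R := K) (n + 1)
      obtain ⟨-, g1, g2⟩ := monic_powSeq (R := K) n
      simp only [zpowF, zpowG, apolyDegree]
      refine ⟨mul_ne_zero f1.ne_zero g1.ne_zero, ?_⟩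
      rw [f1.natDegree_mul g1, f2, g2]; omega
  | negSucc k =>
    obtain ⟨⟨f1, f2⟩, g1, g2⟩ := monic_powSeq (R := K) k
    simp only [zpowF, zpowG, apolyDegree, mul_neg, natDegree_neg]
    refine ⟨neg_ne_zero.2 (mul_ne_zero f1.ne_zero g1.ne_zero), ?_⟩
    rw [f1.natDegree_mul g1, f2, g2]; omega

theorem eval_zpow {R : Type*} [CommRing R] (x : R) (n : ℤ) :
    (zpowF X n).eval x = zpowF x n ∧ (zpowG X n).eval x = zpowG x n := by
  have h := fun n => map_powSeq (evalRingHom x) X 1 n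
  simp only [coe_evalRingHom, eval_X, eval_one] at h
  cases n <;> simp [zpowF, zpowG, h]

/-- This is det(v^n) = 1, written in terms of the Cayley–Hamilton coefficients. -/
theorem zpow_quadratic {R : Type*} [CommRing R] (x : R) (n : ℤ) :
    zpowF x n ^ 2 - x * zpowG x n ^ 2 = 1 + x * (zpowF x n * zpowG x n) := by
  have h : ∀ n : ℕ, powF x 1 n ^ 2 - x * powG x 1 n ^ 2 = 1 + x * (powF x 1 n * powG x 1 n) := by
    intro n
    induction n with
    | zero => simp
    | succ n ih => rw [powF_succ, powG_succ]; linear_combination ih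
  cases n with
  | ofNat n => exact h n
  | negSucc k =>
    simp only [zpowF, zpowG, powG_succ]
    linear_combination h k

end Degree

section Counting

variable {K : Type*} [Field K]

theorem sq_sub_derivative_ne_zero {H : K[X]} (hH : H ≠ 0) : H ^ 2 - derivative H ≠ 0 := by
  intro h
  have h' : H ^ 2 = derivative H := sub_eq_zero.1 h
  rcases Nat.eq_zero_or_pos H.natDegree with h0 | h0
  · rw [derivative_of_natDegree_zero h0] at h'
    exact hH (pow_eq_zero_iff two_ne_zero |>.1 h')
  · have := congrArg natDegree h'
    rw [natDegree_pow] at this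
    have := natDegree_derivative_lt h0.ne'
    omega

/-- At a double root e of (κ - X) H - 1, eliminating κ - e gives H'(e) = H(e)², and then κ = e + 1 /
H(e). The hypothesis excludes exactly these values, so all roots are simple. -/
theorem exists_card_roots_of_generic [IsAlgClosed K] {H : K[X]} (hH : H ≠ 0) {κ : K}
    (hκ : ∀ e, (H ^ 2 - derivative H).IsRoot e → κ ≠ e + (H.eval e)⁻¹) :
    ∃ s : Finset K, s.card = H.natDegree + 1 ∧ ∀ e ∈ s, (κ - e) * H.eval e = 1 := by
  classical
  set P := (C κ - X) * H - 1 with hP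
  have hd : P.natDegree = H.natDegree + 1 := by
    have h1 : (C κ - X : K[X]).natDegree = 1 := by
      rw [← neg_sub, natDegree_neg, natDegree_X_sub_C]
    have h0 : (C κ - X : K[X]) ≠ 0 := by
      rintro h; rw [h] at h1; simp at h1
    rw [hP, ← C_1, natDegree_sub_C, natDegree_mul h0 hH, h1, add_comm]
  have hP0 : P ≠ 0 := by
    rintro h; rw [h] at hd; simp at hd
  have hnd : P.roots.Nodup := by
    rw [Multiset.nodup_iff_count_le_one]
    intro e
    rw [count_roots]
    by_contra hlt
    rw [not_le, one_lt_rootMultiplicity_iff_isRoot hP0] at hlt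
    obtain ⟨r1, r2⟩ := hlt
    simp only [hP, IsRoot, eval_sub, eval_mul, eval_C, eval_X, eval_one, derivative_sub,
      derivative_mul, derivative_C, derivative_X, derivative_one, eval_add, eval_zero] at r1 r2
    have hHe : H.eval e ≠ 0 := by
      rintro h; rw [h] at r1; simp at r1
    refine hκ e ?_ ?_
    · simp only [IsRoot, eval_sub, eval_pow]
      linear_combination (derivative H).eval e * r1 - H.eval e * r2
    · have : κ - e = (H.eval e)⁻¹ := eq_inv_of_mul_eq_one_left (by linear_combination r1)
      rw [← this]; ring
  refine ⟨P.roots.toFinset, ?_, fun e he => ?_⟩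
  · rw [Multiset.toFinset_card_of_nodup hnd, ← hd]
    exact (IsAlgClosed.splits P).natDegree_eq_card_roots.symm
  · have := isRoot_of_mem_roots (Multiset.mem_toFinset.1 he)
    simp only [hP, IsRoot, eval_sub, eval_mul, eval_C, eval_X, eval_one] at this
    exact sub_eq_zero.1 this

/-- With e prescribed, the Riley equation is linear in L. By `zpow_quadratic` the assumption on e
becomes f² - e g² = κ f g, which says that the L so obtained has trace coordinate e. -/
theorem exists_root_of_zpow {n : ℤ} {M e κ : K} (hM : M ≠ 0) (hM4 : M ^ 4 ≠ 1)
    (hκ : κ * M ^ 2 = (M ^ 2 - 1) ^ 2) (he : (κ - e) * (zpowF e n * zpowG e n) = 1) :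
    ∃ L, apoly n L M = 0 ∧ 1 + L * M ^ 2 ≠ 0 ∧
      M ^ 2 * (1 + L * M ^ 2) ^ 2 * e = (1 - M ^ 2) ^ 2 * ((L - 1) * (L * M ^ 4 - 1)) := by
  obtain ⟨f, hf⟩ : ∃ f, f = zpowF e n := ⟨_, rfl⟩
  obtain ⟨g, hg⟩ : ∃ g, g = zpowG e n := ⟨_, rfl⟩
  have quad := zpow_quadratic e n
  rw [← hf, ← hg] at he quad
  have hg0 : g ≠ 0 := by rintro rfl; simp at he
  have rel : f ^ 2 - e * g ^ 2 = κ * f * g := by linear_combination quad - he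
  obtain ⟨q, hq⟩ : ∃ q, q = f - (M ^ 2 - 1) * g := ⟨_, rfl⟩
  have hq0 : q ≠ 0 := by
    intro h
    have hfg : f = (M ^ 2 - 1) * g := by linear_combination h - hq
    -- A vanishing denominator of L would force κ = e, contradicting `he`.
    have h1 : g ^ 2 * (κ - e) = 0 := by
      rw [hfg] at rel
      linear_combination rel + g ^ 2 * hκ
    have h2 : κ - e = 0 := (mul_eq_zero.1 h1).resolve_left (pow_ne_zero 2 hg0)
    rw [h2, zero_mul] at he
    exact zero_ne_one he
  have hM4' : M ^ 4 - 1 ≠ 0 := sub_ne_zero.2 hM4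
  obtain ⟨L, hL⟩ : ∃ L, L = -(M ^ 2 * f + (M ^ 2 - 1) * g) / (M ^ 4 * q) := ⟨_, rfl⟩
  have eD : 1 + L * M ^ 2 = -(M ^ 4 - 1) * g / (M ^ 2 * q) := by
    rw [hL]; field_simp; rw [hq]; ring
  have eU : L * M ^ 4 - 1 = -(M ^ 2 + 1) * f / q := by
    rw [hL]; field_simp; rw [hq]; ring
  have eL : L - 1 = (M ^ 2 + 1) * (-M ^ 2 * f + (M ^ 2 - 1) ^ 2 * g) / (M ^ 4 * q) := by
    rw [hL]; field_simp; rw [hq]; ring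
  have hD : 1 + L * M ^ 2 ≠ 0 := by
    rw [eD]
    exact div_ne_zero (mul_ne_zero (neg_ne_zero.2 hM4') hg0) (mul_ne_zero (pow_ne_zero 2 hM) hq0)
  have hx : M ^ 2 * (1 + L * M ^ 2) ^ 2 * e = (1 - M ^ 2) ^ 2 * ((L - 1) * (L * M ^ 4 - 1)) := by
    rw [eD, eU, eL]
    field_simp
    linear_combination -(M ^ 4 - 1) ^ 2 * M ^ 2 * rel - (M ^ 4 - 1) ^ 2 * f * g * hκ
  refine ⟨L, ?_, hD, hx⟩
  rw [apoly_eq_zero_iff n hM hD hx, ← hf, ← hg, eD, eU]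
  field_simp
  ring

theorem apoly_zero_left {R : Type*} [CommRing R] (n : ℤ) (M : R) :
    apoly n 0 M = match n with
      | Int.ofNat n => -M ^ (4 * n)
      | Int.negSucc _ => 1 := by
  have h : ∀ n : ℕ, powF ((1 - M ^ 2) ^ 2) (M ^ 2) n - (1 - M ^ 2) * powG ((1 - M ^ 2) ^ 2) (M ^ 2) n =
      M ^ (4 * n) ∧
      M ^ 2 * powF ((1 - M ^ 2) ^ 2) (M ^ 2) n +
        (1 - M ^ 2) * powG ((1 - M ^ 2) ^ 2) (M ^ 2) (n + 1) = 1 := by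
    intro n
    induction n with
    | zero => simp [powG_succ]
    | succ n ih =>
      refine ⟨?_, ?_⟩
      · rw [powF_succ, powG_succ, show 4 * (n + 1) = 4 * n + 4 by omega, pow_add, ← ih.1]; ring
      · rw [powG_succ _ _ (n + 1), powF_succ]
        linear_combination ih.2
  cases n with
  | ofNat n =>
    simp only [apoly]
    rw [← (h n).1]
    simp
    ring
  | negSucc k =>
    simp only [apoly]
    refine Eq.trans ?_ (h k).2
    simp
    ring

theorem apoly_zero_left_ne_zero (n : ℤ) {M : K} (hM : M ≠ 0) : apoly n 0 M ≠ 0 := by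
  rw [apoly_zero_left]
  cases n
  · exact neg_ne_zero.2 (pow_ne_zero _ hM)
  · exact one_ne_zero

theorem eval_apoly {R : Type*} [CommRing R] (n : ℤ) (L M : R) :
    (apoly n X (C M)).eval L = apoly n L M := by
  have := map_apoly (evalRingHom L) n X (C M)
  simpa using this

/-- The distinct values e give distinct roots L, because L determines e when 1 + L M² ≠ 0. Their
number equals the degree bound in L, which leaves no room for a double root. -/
theorem not_sq_dvd_apoly [IsAlgClosed K] {n : ℤ} (hn : n ≠ 0) {M κ : K} (hM : M ≠ 0)
    (hM4 : M ^ 4 ≠ 1) (hκ : κ * M ^ 2 = (M ^ 2 - 1) ^ 2)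
    (hgen : ∀ e, IsRoot ((zpowF (X : K[X]) n * zpowG X n) ^ 2 -
      derivative (zpowF (X : K[X]) n * zpowG X n)) e →
      κ ≠ e + ((zpowF X n * zpowG X n).eval e)⁻¹) (L : K) :
    ¬ (X - C L) ^ 2 ∣ apoly n X (C M) := by
  obtain ⟨hH, hd⟩ := zpowF_mul_zpowG (K := K) hn
  classical
  obtain ⟨s, hcard, hs⟩ := exists_card_roots_of_generic hH hgen
  have hA0 : apoly n X (C M) ≠ 0 := by
    intro h
    apply apoly_zero_left_ne_zero n hM
    rw [← eval_apoly, h, eval_zero]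
  have hroot : ∀ e ∈ s, ∃ L, apoly n L M = 0 ∧ 1 + L * M ^ 2 ≠ 0 ∧
      M ^ 2 * (1 + L * M ^ 2) ^ 2 * e = (1 - M ^ 2) ^ 2 * ((L - 1) * (L * M ^ 4 - 1)) := by
    intro e he
    have := hs e he
    rw [eval_mul, (eval_zpow e n).1, (eval_zpow e n).2] at this
    exact exists_root_of_zpow hM hM4 hκ this
  choose! l hl1 hl2 hl3 using hroot
  have hle : s.card ≤ (apoly n X (C M)).roots.toFinset.card := by
    refine Finset.card_le_card_of_injOn l ?_ ?_
    · intro e he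
      simp only [Finset.mem_coe, Multiset.mem_toFinset]
      rw [mem_roots hA0, IsRoot, eval_apoly, hl1 e he]
    · intro e he e' he' h
      have h1 := hl3 e he
      have h2 := hl3 e' he'
      rw [← h, ← h1] at h2
      exact (mul_left_cancel₀ (mul_ne_zero (pow_ne_zero 2 hM) (pow_ne_zero 2 (hl2 e he))) h2).symm
  intro hdvd
  have hdeg := natDegree_apoly_le n M
  have h1 := card_roots' (apoly n X (C M))
  have h2 : ¬ (apoly n X (C M)).roots.Nodup := by
    rw [Multiset.nodup_iff_count_le_one]
    push Not
    refine ⟨L, ?_⟩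
    rw [count_roots]
    exact (le_rootMultiplicity_iff hA0).2 hdvd
  have h3 : (apoly n X (C M)).roots.toFinset.card < Multiset.card (apoly n X (C M)).roots :=
    lt_of_le_of_ne (Multiset.toFinset_card_le _) fun h =>
      h2 (Multiset.toFinset_card_eq_card_iff_nodup.1 h)
  omega

end Counting

end Polynomial

/-! ### Squarefreeness in two variables -/

namespace Polynomial

open TwistKnot

variable {K : Type*} [Field K]

theorem map_apoly_evalRingHom (n : ℤ) (M : K) :
    (apoly n (X : K[X][X]) (C X)).map (evalRingHom M) = apoly n X (C M) := by
  have := map_apoly (mapRingHom (evalRingHom M)) n (X : K[X][X]) (C X)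
  simpa using this

theorem apoly_two_zero (n : ℤ) [CharZero K] : apoly n (2 : K) 0 ≠ 0 := by
  have h : ∀ n : ℕ, powF (-1 : K) 0 n = (-1) ^ n ∧ powG (-1 : K) 0 (n + 1) = (-1) ^ n := by
    intro n
    induction n with
    | zero => simp [powG_succ]
    | succ n ih =>
      have h1 : powF (-1 : K) 0 (n + 1) = (-1) ^ (n + 1) := by
        rw [powF_succ, ih.2]; ring
      refine ⟨h1, ?_⟩
      rw [powG_succ, h1]; ring
  cases n with
  | ofNat n =>
    simp only [apoly]
    norm_num
    obtain _ | n := n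
    · simp
    · rw [(h (n + 1)).1, (h n).2, pow_succ]
      have : ((-1 : K) ^ n) ≠ 0 := pow_ne_zero _ (by norm_num)
      intro h0
      apply this
      have h2 : (2 : K) ≠ 0 := two_ne_zero
      apply mul_left_cancel₀ h2
      linear_combination h0
  | negSucc k =>
    simp only [apoly]
    norm_num
    rw [(h k).2]
    exact pow_ne_zero _ (by norm_num)

theorem apoly_one_one_ne_zero (n : ℤ) [CharZero K] : apoly n (1 : K) 1 ≠ 0 := by
  have h : ∀ (W : K) (n : ℕ), powF 0 W n = W ^ n := by
    intro W n
    induction n with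
    | zero => simp
    | succ n ih => rw [powF_succ, ih]; ring
  cases n with
  | ofNat n =>
    simp only [apoly]
    norm_num
    rw [h]
    exact pow_ne_zero _ (by norm_num)
  | negSucc k =>
    simp only [apoly]
    norm_num
    rw [h]
    exact pow_ne_zero _ (by norm_num)

theorem apoly_map_ne_zero [CharZero K] (n : ℤ) (M : K) : apoly n X (C M) ≠ 0 := by
  intro h
  by_cases hM : M = 0
  · subst hM
    apply apoly_two_zero (K := K) n
    rw [← eval_apoly, h, eval_zero]
  · apply apoly_zero_left_ne_zero n hM
    rw [← eval_apoly, h, eval_zero]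

theorem squarefree_apoly [IsAlgClosed K] [CharZero K] (n : ℤ) :
    Squarefree (apoly n (X : K[X][X]) (C X)) := by
  rcases eq_or_ne n 0 with rfl | hn
  · have : apoly 0 (X : K[X][X]) (C X) = -1 := by
      change apoly (Int.ofNat 0) _ _ = _
      simp [apoly]
    rw [this]
    exact IsUnit.squarefree (isUnit_one (M := K[X][X])).neg
  intro q hq
  have hq' : ∀ M, (q.map (evalRingHom M)) ^ 2 ∣ apoly n X (C M) := by
    intro M
    rw [← map_apoly_evalRingHom, ← Polynomial.map_pow, sq]
    exact Polynomial.map_dvd _ hq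
  have hdeg : q.natDegree = 0 := by
    by_contra hd
    set H : K[X] := zpowF X n * zpowG X n with hH
    have hT := sq_sub_derivative_ne_zero (zpowF_mul_zpowG (K := K) hn).1
    rw [← hH] at hT
    classical
    set bad : Finset K := (H ^ 2 - derivative H).roots.toFinset.image
      (fun e => e + (H.eval e)⁻¹) with hbad
    -- A nonzero value of this polynomial at M guarantees M ≠ 0, M⁴ ≠ 1, that q keeps its degree in
    -- L, and that κ avoids the finitely many bad values.
    have hN : X * (X ^ 4 - 1) * q.leadingCoeff *
        ∏ κ ∈ bad, ((X ^ 2 - 1) ^ 2 - C κ * X ^ 2 : K[X]) ≠ 0 := by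
      have h4 : (X ^ 4 - 1 : K[X]) ≠ 0 := by
        intro h
        have := congrArg (eval 0) h
        simp at this
      have hq0 : q ≠ 0 := by
        rintro rfl; simp at hd
      refine mul_ne_zero (mul_ne_zero (mul_ne_zero X_ne_zero h4) (leadingCoeff_ne_zero.2 hq0)) ?_
      rw [Finset.prod_ne_zero_iff]
      intro κ _ h
      have := congrArg (eval 0) h
      simp at this
    obtain ⟨M, hM⟩ : ∃ M, eval M (X * (X ^ 4 - 1) * q.leadingCoeff *
        ∏ κ ∈ bad, ((X ^ 2 - 1) ^ 2 - C κ * X ^ 2 : K[X])) ≠ 0 := by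
      by_contra! h
      exact hN (Polynomial.funext fun r => by rw [h, eval_zero])
    rw [eval_mul, eval_mul, eval_mul, eval_prod] at hM
    obtain ⟨hM1, hMbad⟩ := mul_ne_zero_iff.1 hM
    obtain ⟨hM2, hMq⟩ := mul_ne_zero_iff.1 hM1
    obtain ⟨hM0, hM4⟩ := mul_ne_zero_iff.1 hM2
    rw [eval_X] at hM0
    simp only [eval_sub, eval_pow, eval_X, eval_one] at hM4
    have hdM : (q.map (evalRingHom M)).degree ≠ 0 := by
      rw [degree_map_eq_of_leadingCoeff_ne_zero _ hMq]
      intro h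
      exact hd (natDegree_eq_zero_iff_degree_le_zero.2 h.le)
    obtain ⟨L, hL⟩ := IsAlgClosed.exists_root _ hdM
    refine not_sq_dvd_apoly hn (κ := (M ^ 2 - 1) ^ 2 / M ^ 2) hM0 (sub_ne_zero.1 hM4)
      (div_mul_cancel₀ _ (pow_ne_zero 2 hM0)) ?_ L
      ((pow_dvd_pow_of_dvd (dvd_iff_isRoot.2 hL) 2).trans (hq' M))
    intro e he hκ
    rw [Finset.prod_ne_zero_iff] at hMbad
    refine hMbad ((M ^ 2 - 1) ^ 2 / M ^ 2) ?_ ?_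
    · rw [hbad, Finset.mem_image]
      exact ⟨e, Multiset.mem_toFinset.2 ((mem_roots hT).2 he), hκ.symm⟩
    · simp only [eval_sub, eval_pow, eval_X, eval_one, eval_mul, eval_C]
      field_simp
      ring
  rw [eq_C_of_natDegree_eq_zero hdeg]
  refine IsUnit.map C ?_
  by_contra hu
  have hdc : (q.coeff 0).degree ≠ 0 := fun h => hu (isUnit_iff_degree_eq_zero.2 h)
  -- A nonconstant factor in M alone would make `apoly` vanish identically on a line of constant M.
  obtain ⟨M, hM⟩ := IsAlgClosed.exists_root _ hdc
  have := hq' M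
  rw [eq_C_of_natDegree_eq_zero hdeg, map_C, coe_evalRingHom, hM, C_0, zero_pow two_ne_zero,
    zero_dvd_iff] at this
  exact apoly_map_ne_zero n M this

end Polynomial

/-! ### Irreducible factors and curves in the eigenvalue variety -/

namespace TwistKnot

/-- Polynomials in `L` and `M` as polynomials in `L` with coefficients in the polynomials in `M`. -/
noncomputable def bivariateEquiv (K : Type*) [Field K] :
    MvPolynomial (Fin 2) K ≃ₐ[K] Polynomial (Polynomial K) :=
  (finSuccEquiv K 1).trans (Polynomial.mapAlgEquiv (uniqueAlgEquiv K (Fin 1)))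

variable {K : Type*} [Field K]

@[simp] theorem bivariateEquiv_X_zero : bivariateEquiv K (X 0) = Polynomial.X := by
  simp [bivariateEquiv, finSuccEquiv_X_zero]

@[simp] theorem bivariateEquiv_X_one : bivariateEquiv K (X 1) = Polynomial.C Polynomial.X := by
  have : finSuccEquiv K 1 (X 1) = Polynomial.C (X 0) := finSuccEquiv_X_succ (j := 0)
  simp [bivariateEquiv, this]

@[simp] theorem bivariateEquiv_C (c : K) :
    bivariateEquiv K (C c) = Polynomial.C (Polynomial.C c) :=
  (bivariateEquiv K).commutes c

theorem bivariateEquiv_apoly (n : ℤ) :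
    bivariateEquiv K (apoly n (X 0) (X 1)) =
      apoly n (Polynomial.X : Polynomial (Polynomial K)) (Polynomial.C Polynomial.X) := by
  have := map_apoly ((bivariateEquiv K : MvPolynomial (Fin 2) K →ₐ[K] Polynomial (Polynomial K)) :
    MvPolynomial (Fin 2) K →+* Polynomial (Polynomial K)) n (X 0) (X 1)
  simpa using this

theorem squarefree_apoly [IsAlgClosed K] [CharZero K] (n : ℤ) :
    Squarefree (apoly n (X 0) (X 1) : MvPolynomial (Fin 2) K) := by
  intro q hq
  have h := map_dvd (bivariateEquiv K) hq
  rw [map_mul, bivariateEquiv_apoly] at h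
  exact (MulEquiv.isUnit_map (bivariateEquiv K)).1 (Polynomial.squarefree_apoly n _ h)

theorem prime_X_zero_sub_C (c : K) : Prime (X 0 - C c : MvPolynomial (Fin 2) K) := by
  rw [← MulEquiv.prime_iff (bivariateEquiv K)]
  have := Polynomial.prime_X_sub_C (Polynomial.C c : Polynomial K)
  simpa using this

theorem prime_X_one_sub_C (c : K) : Prime (X 1 - C c : MvPolynomial (Fin 2) K) := by
  rw [← MulEquiv.prime_iff (bivariateEquiv K)]
  have := Polynomial.prime_C_iff.2 (Polynomial.prime_X_sub_C c)
  simpa using this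

theorem eval_apoly (n : ℤ) (u : Fin 2 → K) :
    eval u (apoly n (X 0) (X 1)) = apoly n (u 0) (u 1) := by
  have := map_apoly (eval u) n (X 0) (X 1)
  simpa using this


theorem dvd_powSeq_sub {R : Type*} [CommRing R] (V W : R) (n : ℕ) :
    W ∣ powF V W n - V ^ n ∧ W ∣ powG V W (n + 1) - V ^ n := by
  induction n with
  | zero => simp [powG_succ]
  | succ n ih =>
    obtain ⟨⟨a, ha⟩, b, hb⟩ := ih
    have h : powF V W (n + 1) - V ^ (n + 1) = W * (powF V W n + V * b) := by
      rw [powF_succ]; linear_combination V * hb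
    refine ⟨⟨_, h⟩, powG V W (n + 1) + (powF V W n + V * b), ?_⟩
    rw [powG_succ]; linear_combination h

section Factors

variable [CharZero K] {n : ℤ} {p : MvPolynomial (Fin 2) K}

theorem not_dvd_X_one_sub_C (hp : Irreducible p) (h : p ∣ apoly n (X 0) (X 1)) (c : K) :
    ¬ p ∣ X 1 - C c := by
  intro hc
  have ha := hp.associated_of_dvd (prime_X_one_sub_C c).irreducible hc
  obtain ⟨q, hq⟩ := ha.symm.dvd.trans h
  have key : ∀ L, apoly n L c = 0 := by
    intro L
    have := congrArg (eval ![L, c]) hq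
    rw [eval_apoly] at this
    simpa using this
  by_cases h0 : c = 0
  · subst h0
    exact Polynomial.apoly_two_zero n (key 2)
  · exact Polynomial.apoly_zero_left_ne_zero n h0 (key 0)

theorem not_dvd_X_one_pow_four_sub_one [IsAlgClosed K] (hp : Irreducible p)
    (h : p ∣ apoly n (X 0) (X 1)) : ¬ p ∣ X 1 ^ 4 - 1 := by
  intro hc
  obtain ⟨i, hi⟩ := IsAlgClosed.exists_pow_nat_eq (-1 : K) (n := 2) (by norm_num)
  have hCi : (C i : MvPolynomial (Fin 2) K) ^ 2 = -1 := by rw [← C_pow, hi, C_neg, C_1]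
  have e : (X 1 ^ 4 - 1 : MvPolynomial (Fin 2) K) =
      (X 1 - C 1) * (X 1 - C (-1)) * ((X 1 - C i) * (X 1 - C (-i))) := by
    rw [C_neg, C_neg, C_1]
    linear_combination (X 1 ^ 2 - 1) * hCi
  rw [e, hp.prime.dvd_mul, hp.prime.dvd_mul, hp.prime.dvd_mul] at hc
  rcases hc with (hc | hc) | hc | hc <;> exact not_dvd_X_one_sub_C hp h _ hc

/-- Modulo 1 + L M² the form W vanishes, so up to sign `apoly` reduces to a power of V, times (1 -
M²)(L M⁴ - 1) when n < 0. A factor shared with any of these would divide M⁴ - 1, which is excluded.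
-/
theorem not_dvd_one_add [IsAlgClosed K] (hp : Irreducible p) (h : p ∣ apoly n (X 0) (X 1)) :
    ¬ p ∣ 1 + X 0 * X 1 ^ 2 := by
  intro hD
  have hne := not_dvd_X_one_pow_four_sub_one hp h
  obtain ⟨D, hDe⟩ : ∃ D : MvPolynomial (Fin 2) K, D = 1 + X 0 * X 1 ^ 2 := ⟨_, rfl⟩
  have hU : ¬ p ∣ (1 - X 1 ^ 2) * (X 0 * X 1 ^ 4 - 1) := by
    rw [hp.prime.dvd_mul]
    rintro (hc | hc)
    · exact hne ((hc.mul_right (-(1 + X 1 ^ 2))).trans (dvd_of_eq (by ring)))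
    · refine hne ((dvd_sub (hD.mul_right (X 1 ^ 2)) hc).mul_right (X 1 ^ 2 - 1) |>.trans
        (dvd_of_eq (by ring)))
  have hV : ¬ p ∣ (1 - X 1 ^ 2) ^ 2 * ((X 0 - 1) * (X 0 * X 1 ^ 4 - 1)) := by
    rw [hp.prime.dvd_mul, hp.prime.dvd_mul]
    rintro (hc | hc | hc)
    · exact hU ((hp.prime.dvd_of_dvd_pow hc).mul_right _)
    · exact hne ((dvd_sub hD (hc.mul_right (X 1 ^ 2))).mul_right (X 1 ^ 2 - 1) |>.trans
        (dvd_of_eq (by ring)))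
    · exact hU (hc.mul_left _)
  have hW : p ∣ X 1 ^ 2 * (1 + X 0 * X 1 ^ 2) ^ 2 := (hD.pow two_ne_zero).mul_left _
  have key := dvd_powSeq_sub ((1 - X 1 ^ 2) ^ 2 * ((X 0 - 1) * (X 0 * X 1 ^ 4 - 1)))
    (X 1 ^ 2 * (1 + X 0 * X 1 ^ 2) ^ 2 : MvPolynomial (Fin 2) K)
  cases n with
  | ofNat n =>
    simp only [apoly, dvd_neg] at h
    rw [dvd_add_left ((hD.mul_right _).mul_right _)] at h
    have := (dvd_sub h (hW.trans (key n).1))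
    rw [sub_sub_cancel] at this
    exact hV (hp.prime.dvd_of_dvd_pow this)
  | negSucc k =>
    simp only [apoly] at h
    rw [dvd_sub_right ((hD.mul_left _).mul_right _)] at h
    rcases hp.prime.dvd_or_dvd h with h | h
    · exact hU h
    have := (dvd_sub h (hW.trans (key k).2))
    rw [sub_sub_cancel] at this
    exact hV (hp.prime.dvd_of_dvd_pow this)

end Factors

theorem dvd_of_forall_eval_eq_zero [IsAlgClosed K] {p q : MvPolynomial (Fin 2) K}
    (hp : Irreducible p) (h : ∀ u, eval u p = 0 → eval u q = 0) : p ∣ q := by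
  have hq : q ∈ vanishingIdeal K (zeroLocus K (Ideal.span {p})) := by
    rw [mem_vanishingIdeal_iff]
    intro u hu
    rw [mem_zeroLocus_iff] at hu
    have := h u (by simpa [aeval_eq_eval] using hu p (Ideal.mem_span_singleton_self p))
    simpa [aeval_eq_eval] using this
  rw [vanishingIdeal_zeroLocus_eq_radical, Ideal.mem_radical_iff] at hq
  obtain ⟨k, hk⟩ := hq
  exact hp.prime.dvd_of_dvd_pow (Ideal.mem_span_singleton.1 hk)

/-- Points of the curve off the exceptional curves are eigenvalue pairs. A polynomial vanishing on
all pairs, multiplied by the exceptional equations, is thus divisible by p, and p divides none of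
those equations. -/
theorem zeroLocus_subset_of_dvd {n : ℤ} {p : MvPolynomial (Fin 2) ℂ} (hp : Irreducible p)
    (h : p ∣ apoly n (X 0) (X 1)) : zeroLocus ℂ (Ideal.span {p}) ⊆
      eigenvalueVariety (twistKnot n).meridian (twistKnot n).longitude := by
  intro u hu
  rw [eigenvalueVariety, mem_zeroLocus_iff]
  intro q hq
  rw [mem_vanishingIdeal_iff] at hq
  rw [mem_zeroLocus_iff] at hu
  have hdvd : p ∣ q * (X 1 * (X 1 ^ 4 - 1) * (1 + X 0 * X 1 ^ 2)) := by
    refine dvd_of_forall_eval_eq_zero hp fun w hw => ?_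
    have hA : apoly n (w 0) (w 1) = 0 := by
      obtain ⟨r, hr⟩ := h
      rw [← eval_apoly, hr, map_mul, hw, zero_mul]
    by_contra hne
    simp only [map_mul, map_sub, map_add, map_pow, map_one, eval_X, mul_eq_zero,
      not_or] at hne
    obtain ⟨hq0, ⟨h0, h4⟩, hD⟩ := hne
    have hmem := mem_eigenvalueSet_of_apoly n h0 (fun h => h4 (sub_eq_zero.2 h)) hD hA
    have hw : ![w 0, w 1] = w := by ext i; fin_cases i <;> rfl
    rw [hw] at hmem
    exact hq0 (by simpa [aeval_eq_eval] using hq w hmem)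
  rcases hp.prime.dvd_or_dvd hdvd with ⟨r, rfl⟩ | hdvd
  · rw [map_mul, hu p (Ideal.mem_span_singleton_self p), zero_mul]
  · exfalso
    rcases hp.prime.dvd_or_dvd hdvd with hdvd | hdvd
    · rcases hp.prime.dvd_or_dvd hdvd with hdvd | hdvd
      · exact not_dvd_X_one_sub_C hp h 0 (by simpa using hdvd)
      · exact not_dvd_X_one_pow_four_sub_one hp h hdvd
    · exact not_dvd_one_add hp h hdvd

theorem dvd_of_zeroLocus_subset {n : ℤ} {p : MvPolynomial (Fin 2) ℂ} (hp : Irreducible p)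
    (h : zeroLocus ℂ (Ideal.span {p}) ⊆
      eigenvalueVariety (twistKnot n).meridian (twistKnot n).longitude) :
    p ∣ (X 0 - 1) * apoly n (X 0) (X 1) := by
  -- The pairs not covered by (L - 1) `apoly` have both coordinates ±1, so either coordinate can be
  -- used to kill them. If p divided only the extra factors, it would divide both some X 0 - a and
  -- some X 1 - b, which is impossible for a curve.
  have van : ∀ i : Fin 2, p ∣ (X 0 - 1) * apoly n (X 0) (X 1) * ((X i - C 1) * (X i - C (-1))) := by
    intro i
    refine dvd_of_forall_eval_eq_zero hp fun w hw => ?_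
    have hw' : w ∈ zeroLocus ℂ (Ideal.span {p}) := by
      rw [zeroLocus_span]
      simpa [aeval_eq_eval] using hw
    have hv := h hw'
    rw [eigenvalueVariety, mem_zeroLocus_iff] at hv
    have := hv ((X 0 - 1) * apoly n (X 0) (X 1) * ((X i - C 1) * (X i - C (-1)))) (by
      rw [mem_vanishingIdeal_iff]
      intro u hu
      rw [aeval_eq_eval, map_mul, map_mul, eval_apoly]
      simp only [map_sub, map_mul, eval_X, eval_C, map_one]
      rcases mem_eigenvalueSet n hu with h1 | ⟨h1, h0⟩
      · rw [h1, zero_mul]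
      · fin_cases i
        · simp only [Fin.zero_eta]
          linear_combination (u 0 - 1) * apoly n (u 0) (u 1) * h0
        · simp only [Fin.mk_one]
          linear_combination (u 0 - 1) * apoly n (u 0) (u 1) * h1)
    simpa [aeval_eq_eval] using this
  by_contra hn
  have h0 := (hp.prime.dvd_or_dvd (van 0)).resolve_left hn
  have h1 := (hp.prime.dvd_or_dvd (van 1)).resolve_left hn
  obtain ⟨a, ha⟩ : ∃ a : ℂ, p ∣ X 0 - C a :=
    (hp.prime.dvd_or_dvd h0).elim (fun h => ⟨_, h⟩) fun h => ⟨_, h⟩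
  obtain ⟨b, hb⟩ : ∃ b : ℂ, p ∣ X 1 - C b :=
    (hp.prime.dvd_or_dvd h1).elim (fun h => ⟨_, h⟩) fun h => ⟨_, h⟩
  have hab := (hp.associated_of_dvd (prime_X_one_sub_C b).irreducible hb).symm.dvd.trans ha
  obtain ⟨r, hr⟩ := hab
  have := congrArg (eval ![a + 1, b]) hr
  simp at this

theorem isAPolynomial_apoly (n : ℤ) : (twistKnot n).IsAPolynomial (apoly n (X 0) (X 1)) := by
  have hmap : MvPolynomial.map (Int.castRingHom ℂ) (apoly n (X (0 : Fin 2)) (X 1)) =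
      apoly n (X 0) (X 1) := by
    rw [map_apoly, map_X, map_X]
  refine ⟨?_, ?_, ?_⟩
  · rintro d ⟨q, hq⟩
    have := congrArg (aeval ![(0 : ℤ), 1]) hq
    rw [← RingHom.coe_coe, map_apoly, map_mul, RingHom.coe_coe, aeval_X, aeval_X, aeval_C] at this
    -- The value at L = 0, M = 1 is ±1, so no nonunit integer divides all coefficients.
    have h1 : IsUnit (apoly n (0 : ℤ) 1) := by
      rw [Polynomial.apoly_zero_left]
      cases n <;> simp
    exact isUnit_of_dvd_unit ⟨_, this⟩ h1
  · rw [hmap]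
    exact squarefree_apoly n
  · intro p hp
    rw [hmap]
    constructor
    · intro h
      refine ⟨zeroLocus_subset_of_dvd hp h, fun ha => ?_⟩
      obtain ⟨r, hr⟩ := ha.symm.dvd.trans h
      apply Polynomial.apoly_one_one_ne_zero (K := ℂ) n
      have := congrArg (eval ![1, 1]) hr
      rw [eval_apoly] at this
      simpa using this
    · rintro ⟨h, hne⟩
      rcases hp.prime.dvd_or_dvd (dvd_of_zeroLocus_subset hp h) with h | h
      · refine absurd (hp.associated_of_dvd ?_ h) hne
        simpa using (prime_X_zero_sub_C (1 : ℂ)).irreducible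
      · exact h

end TwistKnot

theorem theorem1p3 (n : ℤ) :
    ∃ A : MvPolynomial (Fin 2) ℤ,
      (twistKnot n).IsAPolynomial A ∧
      algebraMap (MvPolynomial (Fin 2) ℤ) (FractionRing (MvPolynomial (Fin 2) ℤ)) A =
        explicitA n
          (algebraMap (MvPolynomial (Fin 2) ℤ) (FractionRing (MvPolynomial (Fin 2) ℤ))
            (MvPolynomial.X 0))
          (algebraMap (MvPolynomial (Fin 2) ℤ) (FractionRing (MvPolynomial (Fin 2) ℤ))
            (MvPolynomial.X 1)) := by
  refine ⟨TwistKnot.apoly n (X 0) (X 1), TwistKnot.isAPolynomial_apoly n, ?_⟩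
  have hinj := IsFractionRing.injective (MvPolynomial (Fin 2) ℤ)
    (FractionRing (MvPolynomial (Fin 2) ℤ))
  rw [TwistKnot.map_apoly, TwistKnot.explicitA_eq_apoly]
  · rw [map_ne_zero_iff _ hinj]
    exact X_ne_zero 1
  · rw [← map_one (algebraMap (MvPolynomial (Fin 2) ℤ) (FractionRing (MvPolynomial (Fin 2) ℤ))),
      ← map_pow, ← map_mul, ← map_add, map_ne_zero_iff _ hinj]
    intro h
    have := congrArg (eval 0) h
    simp at this
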